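/- There is a universal constant $c>1$ such that the following holds. Let $\varepsilon>0$, let $n,\Delta,b$ be integers with $1\le b\le \Delta/2$, and let $G$ be a $\Delta$-regular simple graph with $n$ nodes and girth at least $\varepsilon\log_\Delta n$ (an acyclic graph has infinite girth). Consider the randomized LOCAL model with shared randomness on $G$. Every node numbers its $\Delta$ incident edges with ports $1,\dots,\Delta$ by an independent, uniformly random permutation; it has a private infinite stream of random bits, and all nodes also read one common infinite stream of random bits (all independent). Nodes have no further identifiers; they run the same algorithm, which may depend on $n$ and $\Delta$. In each round every node sends one message of unbounded size over each of its ports and updates its state by an arbitrary (measurable) function of its state and the messages received. After $T$ rounds a $T$-round algorithm outputs, at every node, a label $\mathsf M$ or $\mathsf U$ on each of the incident half-edges. In the $b$-grabbing problem each node has to output $\mathsf M$ on exactly $b$ of its incident half-edges and $\mathsf U$ on the others. An edge is matched if both its half-edges are labeled $\mathsf M$. The badness of a solution with $q$ matched edges is $1-\frac{2q}{bn}$. An algorithm is no-error if its output is always (for all port numberings and all values of the random bits) a solution. Let $p>0$. Then every no-error $T$-round algorithm for $b$-grabbing on $G$ whose expected badness, over the random port numbering and the random bits, is at most $p$ satisfies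 $$T\;\ge\;\min\left\{\frac{\varepsilon}{4}\log_\Delta n,\ \frac{\log\bigl(1/(2p)\bigr)}{\log\bigl(c\sqrt b\bigr)}\right\}.$$ -/

import Mathlib

open MeasureTheory

namespace LocalModel

/-! ### Half-edge labelings and `b`-grabbing -/

/-- The two output labels on half-edges. -/
inductive Label : Type
  | M : Label
  | U : Label

instance : MeasurableSpace Label := ⊤

/-- A labeling of the half-edges of `G` by `M` and `U`. The half-edge `(v, {v, w})` is represented
by the dart from `v` to `w`; the other half-edge of the same edge is the reversed dart. -/
abbrev HalfEdgeLabeling {V : Type} (G : SimpleGraph V) : Type := G.Dart → Label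

/-- `ℓ` solves the `b`-grabbing problem: every node has label `M` on exactly `b` of its incident
half-edges (and hence `U` on all the other ones). -/
def IsGrabbing {V : Type} {G : SimpleGraph V} (b : ℕ) (ℓ : HalfEdgeLabeling G) : Prop :=
  ∀ v : V, {d : G.Dart | d.fst = v ∧ ℓ d = Label.M}.ncard = b

/-- The matched edges: those that are grabbed by both endpoints. -/
def matchedEdges {V : Type} {G : SimpleGraph V} (ℓ : HalfEdgeLabeling G) : Set (Sym2 V) :=
  {e | ∃ d : G.Dart, d.edge = e ∧ ℓ d = Label.M ∧ ℓ d.symm = Label.M}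

/-- The quality of a solution is the number of matched edges. -/
noncomputable def quality {V : Type} {G : SimpleGraph V} (ℓ : HalfEdgeLabeling G) : ℕ :=
  (matchedEdges ℓ).ncard

/-- The badness `1 - 2 q / (b n)` of a solution of quality `q` on an `n`-node graph. -/
noncomputable def badness {V : Type} [Fintype V] {G : SimpleGraph V} (b : ℕ)
    (ℓ : HalfEdgeLabeling G) : ℝ :=
  1 - 2 * (quality ℓ : ℝ) / ((b : ℝ) * (Fintype.card V : ℝ))

/-! ### Randomness and port numbers -/

/-- An infinite stream of bits. -/
abbrev BitStream : Type := ℕ → Bool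

/-- The law of an infinite stream of independent fair bits. -/
noncomputable def bitMeasure : Measure BitStream :=
  Measure.infinitePi fun _ : ℕ => (PMF.uniformOfFintype Bool).toMeasure

/-- The joint law of the random bits: each node has its own private stream, and there is one further
stream that is shared by all the nodes; all the streams are independent. -/
noncomputable def randomnessMeasure (V : Type) [Fintype V] :
    Measure ((V → BitStream) × BitStream) :=
  (Measure.pi fun _ : V => bitMeasure).prod bitMeasure

/-- A port numbering of a `Δ`-regular graph: every node numbers its incident edges (equivalently,
its neighbors) by the ports `0, …, Δ - 1`. The numberings at different nodes are unrelated. -/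
abbrev PortNumbering {V : Type} (G : SimpleGraph V) (Δ : ℕ) : Type :=
  (v : V) → Fin Δ ≃ G.neighborSet v

/-! ### The randomized LOCAL model with shared randomness -/

/-- A randomized algorithm in the LOCAL model with shared randomness, for graphs in which all degrees
are `Δ`, with an output label on every port. All nodes run the same algorithm. The initial state of
a node depends on its private bit stream and on the shared bit stream only. In each round a node
sends one message, of unrestricted size, through each of its ports, and then updates its state
according to the messages received through its ports. After `rounds` rounds the node computes its
output from its state. The algorithm is not required to be uniform in the graph or in its size, so
that it may in particular use the number of nodes. -/
structure LocalAlgorithm (Δ : ℕ) where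
  State : Type
  Msg : Type
  [measurableSpaceState : MeasurableSpace State]
  [measurableSpaceMsg : MeasurableSpace Msg]
  /-- initial state, from the private and the shared bits -/
  init : BitStream × BitStream → State
  /-- the message that a node in a given state sends through each port -/
  send : State → Fin Δ → Msg
  /-- the new state, from the old state and the message received on each port -/
  recv : State × (Fin Δ → Msg) → State
  /-- the final label on each port -/
  output : State → Fin Δ → Label
  /-- the running time -/
  rounds : ℕ
  measurable_init : Measurable init
  measurable_send : Measurable send
  measurable_recv : Measurable recv
  measurable_output : Measurable output

attribute [instance] LocalAlgorithm.measurableSpaceState LocalAlgorithm.measurableSpaceMsg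

namespace LocalAlgorithm

variable {V : Type} {G : SimpleGraph V} {Δ : ℕ}

/-- The states of all nodes after `t` rounds, in the execution with port numbering `π`, private bits
`ω.1` and shared bits `ω.2`. On port `i` the node `v` receives the message that its neighbor
`π v i` sends through the port leading to `v`. -/
def stateAt (A : LocalAlgorithm Δ) (π : PortNumbering G Δ) (ω : (V → BitStream) × BitStream) :
    ℕ → V → A.State
  | 0 => fun v => A.init (ω.1 v, ω.2)
  | t + 1 => fun v =>
      A.recv (A.stateAt π ω t v, fun i =>
        A.send (A.stateAt π ω t (π v i)) ((π (π v i)).symm ⟨v, (π v i).2.symm⟩))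

/-- The half-edge labeling produced by an execution. -/
def outputLabeling (A : LocalAlgorithm Δ) (π : PortNumbering G Δ)
    (ω : (V → BitStream) × BitStream) : HalfEdgeLabeling G :=
  fun d => A.output (A.stateAt π ω A.rounds d.fst) ((π d.fst).symm ⟨d.snd, d.adj⟩)

/-- `A` is a no-error algorithm for `b`-grabbing on `G`: the output is always a solution. -/
def IsNoErrorGrabbing (A : LocalAlgorithm Δ) (G : SimpleGraph V) (b : ℕ) : Prop :=
  ∀ (π : PortNumbering G Δ) (ω : (V → BitStream) × BitStream), IsGrabbing b (A.outputLabeling π ω)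

open Classical in
/-- The expected badness of the output of `A` on `G`, where each node numbers its ports by an
independent, uniformly random permutation (so that the port numbering is uniformly distributed on the
finite set of all port numberings), independently of the random bits. -/
noncomputable def expectedBadness [Fintype V] (A : LocalAlgorithm Δ) (G : SimpleGraph V) (b : ℕ) :
    ℝ :=
  (∑ π : PortNumbering G Δ, ∫ ω, badness b (A.outputLabeling π ω) ∂(randomnessMeasure V)) /
    (Fintype.card (PortNumbering G Δ) : ℝ)

end LocalAlgorithm

end LocalModel

/-! ### Moment bounds and the resampling inequality. -/

namespace LocalModel
open ProbabilityTheory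

/-! The proof is a round elimination on the `Δ`-regular tree. If the running time `T` is below `ε /
4 * log_Δ n`, then `4 T` is below the girth, and what the two ends of an edge see is distributed as
in a random port-numbered tree, with independent branches on the two sides
(`map_randomBranch_prod`). Once the shared bits are fixed, the algorithm is a rule that selects
exactly `b` ports from the view of a node. Let `μ` (`mismatch`) be the probability that an edge of
the tree is selected by exactly one end. Counting half-edges (`badness_mul_eq`), the expected
badness is the average over the shared bits of `Δ μ / (2 b)`.

With zero rounds the ends of an edge decide independently, each selecting it with probability `b / Δ
≤ 1 / 2`, so `μ ≥ b / Δ` (`le_mismatch_zero`). Saving one round multiplies `μ` by at most `46 √b`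
(`exists_round_elimination`). Hence `μ ≥ (b / Δ) (46 √b)^(-T)`, the expected badness is at least
`(46 √b)^(-T) / 2`, and `c = 46` works.

To save a round, condition on the branches of depth `t + 1` on both sides of an edge. Beyond these,
each end of a `(t + 1)`-round rule sees only the last level behind its own other ports, so the two
decisions are conditionally independent (`mismatch_eq`). If they rarely disagree, each is nearly
determined by the conditioning: it rarely differs from its more likely value `Y`. For port `i` of a
node, `Y i` depends only on the `t`-view of the node and on the last level behind port `i`. The
shortened rule runs the old one on the `t`-view completed by an invented last level (`simulate`).
Its decision `X i` must be compared with `Y i` computed from the true last level, which is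
independent of the invented one.

This is the resampling inequality `sum_resampled_le`. At a fixed `t`-view the `Y i` are independent,
and they are close to variables `X i` whose sum is always `b`. So `∑ Y i` hardly fluctuates, and by
a fourth moment bound (`second_moment_le`) independence forces the total variance of the `Y i` to be
small too. Replacing them by fresh copies therefore costs only a factor of order `√b`. The invented
level is finally fixed by averaging, so the shortened rule is again deterministic. -/

theorem abs_le_one_of_cube_eq {x : ℝ} (h : x ^ 3 = x) : |x| ≤ 1 := by
  have h1 : x * (x - 1) * (x + 1) = 0 := by linear_combination h
  rcases mul_eq_zero.1 h1 with h2 | h2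
  · rcases mul_eq_zero.1 h2 with h3 | h3
    · simp [h3]
    · rw [sub_eq_zero.1 h3]; simp
  · rw [eq_neg_of_add_eq_zero_left h2]; simp

/-- Second and fourth moments of a sum of independent centered variables with values in
`{-1, 0, 1}`. -/
theorem moments_sum {Ω ι : Type*} [MeasurableSpace Ω] {μ : Measure Ω} [IsProbabilityMeasure μ]
    {w : ι → Ω → ℝ} (hm : ∀ i, Measurable (w i)) (h3 : ∀ i ω, w i ω ^ 3 = w i ω)
    (h0 : ∀ i, ∫ ω, w i ω ∂μ = 0) (hind : iIndepFun w μ) (s : Finset ι) :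
    ∫ ω, (∑ i ∈ s, w i ω) ^ 2 ∂μ = ∑ i ∈ s, ∫ ω, w i ω ^ 2 ∂μ ∧
    ∫ ω, (∑ i ∈ s, w i ω) ^ 4 ∂μ ≤
      (∑ i ∈ s, ∫ ω, w i ω ^ 2 ∂μ) + 3 * (∑ i ∈ s, ∫ ω, w i ω ^ 2 ∂μ) ^ 2 := by
  classical
  induction s using Finset.induction_on with
  | empty => simp
  | insert a s ha ih =>
    set S : Ω → ℝ := fun ω => ∑ i ∈ s, w i ω with hS
    have hSm : Measurable S := Finset.measurable_sum _ fun i _ => hm i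
    have hSb : ∀ ω, |S ω| ≤ s.card := fun ω => by
      refine (Finset.abs_sum_le_sum_abs _ _).trans ?_
      refine (Finset.sum_le_sum fun i _ => abs_le_one_of_cube_eq (h3 i ω)).trans ?_
      simp
    have hSi : ∀ k : ℕ, Integrable (fun ω => S ω ^ k) μ := fun k => by
      refine Integrable.of_bound (hSm.pow_const k).aestronglyMeasurable ((s.card : ℝ) ^ k)
        (Filter.Eventually.of_forall fun ω => ?_)
      rw [norm_pow, Real.norm_eq_abs]
      exact pow_le_pow_left₀ (abs_nonneg _) (hSb ω) k
    have hwi : ∀ k : ℕ, Integrable (fun ω => w a ω ^ k) μ := fun k => by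
      refine Integrable.of_bound ((hm a).pow_const k).aestronglyMeasurable 1
        (Filter.Eventually.of_forall fun ω => ?_)
      rw [norm_pow, Real.norm_eq_abs]
      exact pow_le_one₀ (abs_nonneg _) (abs_le_one_of_cube_eq (h3 a ω))
    have hI : IndepFun S (w a) μ := by
      have := hind.indepFun_finsetSum_of_notMem hm ha
      convert this using 1
      ext ω; simp [hS]
    have hIk : ∀ k l : ℕ, IndepFun (fun ω => S ω ^ k) (fun ω => w a ω ^ l) μ := fun k l =>
      hI.comp (measurable_id.pow_const k) (measurable_id.pow_const l)
    have hprod : ∀ k l : ℕ, ∫ ω, S ω ^ k * w a ω ^ l ∂μ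
        = (∫ ω, S ω ^ k ∂μ) * ∫ ω, w a ω ^ l ∂μ := fun k l =>
      (hIk k l).integral_fun_mul_eq_mul_integral (hSi k).aestronglyMeasurable
        (hwi l).aestronglyMeasurable
    have hprodi : ∀ k l : ℕ, Integrable (fun ω => S ω ^ k * w a ω ^ l) μ := fun k l =>
      (hIk k l).integrable_mul (hSi k) (hwi l)
    have hw1 : ∫ ω, w a ω ^ 1 ∂μ = 0 := by simpa using h0 a
    have e2 : ∫ ω, (∑ i ∈ insert a s, w i ω) ^ 2 ∂μ
        = ∫ ω, S ω ^ 2 ∂μ + ∫ ω, w a ω ^ 2 ∂μ := by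
      have : ∀ ω, (∑ i ∈ insert a s, w i ω) ^ 2
          = S ω ^ 2 + w a ω ^ 2 + 2 * (S ω ^ 1 * w a ω ^ 1) := fun ω => by
        rw [Finset.sum_insert ha]; ring
      simp_rw [this]
      rw [integral_add ((hSi 2).fun_add (hwi 2)) ((hprodi 1 1).const_mul 2),
        integral_add (hSi 2) (hwi 2), integral_const_mul, hprod, hw1]
      ring
    have e4 : ∫ ω, (∑ i ∈ insert a s, w i ω) ^ 4 ∂μ
        = ∫ ω, S ω ^ 4 ∂μ + ∫ ω, w a ω ^ 2 ∂μ
          + 6 * ((∫ ω, S ω ^ 2 ∂μ) * ∫ ω, w a ω ^ 2 ∂μ) := by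
      -- Since `w ^ 3 = w`, the terms `w ^ 4` and `S * w ^ 3` become `w ^ 2` and `S * w`; all terms
      -- linear in `w` integrate to zero.
      have : ∀ ω, (∑ i ∈ insert a s, w i ω) ^ 4
          = (S ω ^ 4 + w a ω ^ 2 + 6 * (S ω ^ 2 * w a ω ^ 2))
            + (4 * (S ω ^ 3 * w a ω ^ 1) + 4 * (S ω ^ 1 * w a ω ^ 1)) := fun ω => by
        rw [Finset.sum_insert ha]
        linear_combination (w a ω + 4 * S ω) * h3 a ω
      simp_rw [this]
      rw [integral_add (((hSi 4).fun_add (hwi 2)).fun_add ((hprodi 2 2).const_mul 6))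
          (((hprodi 3 1).const_mul 4).fun_add ((hprodi 1 1).const_mul 4)),
        integral_add ((hSi 4).fun_add (hwi 2)) ((hprodi 2 2).const_mul 6),
        integral_add (hSi 4) (hwi 2),
        integral_add ((hprodi 3 1).const_mul 4) ((hprodi 1 1).const_mul 4)]
      simp only [integral_const_mul, hprod, hw1]
      ring
    obtain ⟨ih2, ih4⟩ := ih
    have hnn : 0 ≤ ∫ ω, w a ω ^ 2 ∂μ := integral_nonneg fun ω => sq_nonneg _
    rw [Finset.sum_insert ha]
    refine ⟨by rw [e2, ← ih2]; ring, ?_⟩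
    rw [e4, ih2]
    nlinarith [sq_nonneg (∫ ω, w a ω ^ 2 ∂μ)]

/-- With `t = |x| / K` this is `t ^ 2 - t ^ 4 ≤ t`. It bounds a first absolute moment below by
second and fourth moments. -/
theorem abs_ge_sq_sub_fourth {K : ℝ} (hK : 0 < K) (x : ℝ) :
    x ^ 2 / K - x ^ 4 / K ^ 3 ≤ |x| := by
  have ht : 0 ≤ |x| / K := by positivity
  set t := |x| / K with htd
  have hx : |x| = K * t := by rw [htd]; field_simp
  have h2 : x ^ 2 = (K * t) ^ 2 := by rw [← hx, sq_abs]
  have h4 : x ^ 4 = (K * t) ^ 4 := by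
    have : x ^ 4 = (x ^ 2) ^ 2 := by ring
    rw [this, h2]; ring
  rw [h2, h4, hx]
  have : (K * t) ^ 2 / K - (K * t) ^ 4 / K ^ 3 = K * (t ^ 2 - t ^ 4) := by field_simp
  rw [this]
  refine mul_le_mul_of_nonneg_left ?_ hK.le
  have : t ^ 2 - t ^ 4 = t * (t - t ^ 3) := by ring
  rw [this]
  have h1 : t - t ^ 3 ≤ 1 := by nlinarith [sq_nonneg (t - 1), mul_nonneg ht (sq_nonneg (t - 1))]
  nlinarith

/-- The second moment of a sum of independent centered variables with values in `{-1, 0, 1}` is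
controlled by its first absolute moment. -/
theorem second_moment_le {Ω ι : Type*} [MeasurableSpace Ω] {μ : Measure Ω}
    [IsProbabilityMeasure μ] {w : ι → Ω → ℝ} (hm : ∀ i, Measurable (w i))
    (h3 : ∀ i ω, w i ω ^ 3 = w i ω) (h0 : ∀ i, ∫ ω, w i ω ∂μ = 0) (hind : iIndepFun w μ)
    (s : Finset ι) :
    ∑ i ∈ s, ∫ ω, w i ω ^ 2 ∂μ ≤
      2 * √(2 + 6 * ∑ i ∈ s, ∫ ω, w i ω ^ 2 ∂μ) * ∫ ω, |∑ i ∈ s, w i ω| ∂μ := by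
  obtain ⟨m2, m4⟩ := moments_sum hm h3 h0 hind s
  set A := ∑ i ∈ s, ∫ ω, w i ω ^ 2 ∂μ with hA
  have hA0 : 0 ≤ A := Finset.sum_nonneg fun i _ => integral_nonneg fun ω => sq_nonneg _
  -- Chosen so that the fourth moment bound `A + 3 * A ^ 2` equals `A * K ^ 2 / 2`; the quartic term
  -- then costs exactly half of `A / K`.
  set K := √(2 + 6 * A) with hKd
  have hK2 : K ^ 2 = 2 + 6 * A := Real.sq_sqrt (by positivity)
  have hK : 0 < K := Real.sqrt_pos.2 (by positivity)
  have hSm : Measurable fun ω => ∑ i ∈ s, w i ω := Finset.measurable_sum _ fun i _ => hm i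
  have hSb : ∀ ω, |∑ i ∈ s, w i ω| ≤ s.card := fun ω => by
    refine (Finset.abs_sum_le_sum_abs _ _).trans ?_
    refine (Finset.sum_le_sum fun i _ => abs_le_one_of_cube_eq (h3 i ω)).trans ?_
    simp
  have hSi : ∀ k : ℕ, Integrable (fun ω => (∑ i ∈ s, w i ω) ^ k) μ := fun k => by
    refine Integrable.of_bound (hSm.pow_const k).aestronglyMeasurable ((s.card : ℝ) ^ k)
      (Filter.Eventually.of_forall fun ω => ?_)
    rw [norm_pow, Real.norm_eq_abs]
    exact pow_le_pow_left₀ (abs_nonneg _) (hSb ω) k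
  have h1 : ∫ ω, ((∑ i ∈ s, w i ω) ^ 2 / K - (∑ i ∈ s, w i ω) ^ 4 / K ^ 3) ∂μ
      ≤ ∫ ω, |∑ i ∈ s, w i ω| ∂μ := by
    refine integral_mono (((hSi 2).div_const _).sub ((hSi 4).div_const _)) ?_
      fun ω => abs_ge_sq_sub_fourth hK _
    simpa using (hSi 1).abs
  rw [integral_sub ((hSi 2).div_const _) ((hSi 4).div_const _), integral_div, integral_div,
    m2] at h1
  set J := ∫ ω, |∑ i ∈ s, w i ω| ∂μ
  have h2 : A / K - (A + 3 * A ^ 2) / K ^ 3 ≤ J := by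
    refine le_trans ?_ h1
    gcongr
  have h4 : A / K - (A + 3 * A ^ 2) / K ^ 3 = A / (2 * K) := by
    have : A + 3 * A ^ 2 = A * K ^ 2 / 2 := by rw [hK2]; ring
    rw [this]; field_simp; ring
  rw [h4, div_le_iff₀ (by positivity)] at h2
  linarith

/-- If independent `{0, 1}`-valued variables `Y i` approximate variables `X i` with a constant sum,
then `X` is also approximated by a resampled copy of `Y`. -/
theorem sum_resampled_le {Ω ι : Type*} [Fintype ι] [MeasurableSpace Ω] {μ : Measure Ω}
    [IsProbabilityMeasure μ] {X Y X' Y' : ι → Ω → ℝ} {b : ℕ} (hb : 1 ≤ b)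
    (mX : ∀ i, Measurable (X i)) (mY : ∀ i, Measurable (Y i))
    (mX' : ∀ i, Measurable (X' i)) (mY' : ∀ i, Measurable (Y' i))
    (vX : ∀ i ω, X i ω = 0 ∨ X i ω = 1) (vY : ∀ i ω, Y i ω = 0 ∨ Y i ω = 1)
    (vX' : ∀ i ω, X' i ω = 0 ∨ X' i ω = 1) (vY' : ∀ i ω, Y' i ω = 0 ∨ Y' i ω = 1)
    (sX : ∀ ω, ∑ i, X i ω = b) (sX' : ∀ ω, ∑ i, X' i ω = b)
    (hind : iIndepFun (fun i ω => Y i ω - Y' i ω) μ)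
    (hY : ∀ i, ∫ ω, Y i ω ∂μ = ∫ ω, Y' i ω ∂μ)
    (hXY : ∀ i, ∫ ω, |X i ω - Y i ω| ∂μ = ∫ ω, |X' i ω - Y' i ω| ∂μ) :
    ∑ i, ∫ ω, |X i ω - Y' i ω| ∂μ ≤ (1 + 21 * √b) * ∑ i, ∫ ω, |X i ω - Y i ω| ∂μ := by
  have key : ∀ {f : Ω → ℝ}, Measurable f → (∀ ω, f ω = 0 ∨ f ω = 1) → Integrable f μ :=
    fun {f} hf hv => Integrable.of_bound hf.aestronglyMeasurable 1
      (Filter.Eventually.of_forall fun ω => by rcases hv ω with h | h <;> simp [h])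
  have iX i := key (mX i) (vX i)
  have iY i := key (mY i) (vY i)
  have iX' i := key (mX' i) (vX' i)
  have iY' i := key (mY' i) (vY' i)
  have h3 : ∀ i ω, (Y i ω - Y' i ω) ^ 3 = Y i ω - Y' i ω := fun i ω => by
    rcases vY i ω with h | h <;> rcases vY' i ω with h' | h' <;> simp [h, h']; norm_num
  have hsq : ∀ i ω, (Y i ω - Y' i ω) ^ 2 = |Y i ω - Y' i ω| := fun i ω => by
    rcases vY i ω with h | h <;> rcases vY' i ω with h' | h' <;> simp [h, h']
  have h0 : ∀ i, ∫ ω, (Y i ω - Y' i ω) ∂μ = 0 := fun i => by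
    rw [integral_sub (iY i) (iY' i), hY, sub_self]
  have hA := second_moment_le (fun i => (mY i).sub (mY' i)) h3 h0 hind Finset.univ
  set D := ∑ i, ∫ ω, |X i ω - Y i ω| ∂μ with hD
  set A := ∑ i, ∫ ω, (Y i ω - Y' i ω) ^ 2 ∂μ with hAd
  have hD' : D = ∑ i, ∫ ω, |X' i ω - Y' i ω| ∂μ := Finset.sum_congr rfl fun i _ => hXY i
  have iXY i : Integrable (fun ω => |X i ω - Y i ω|) μ := ((iX i).sub (iY i)).abs
  have iXY' i : Integrable (fun ω => |X' i ω - Y' i ω|) μ := ((iX' i).sub (iY' i)).abs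
  have iYY' i : Integrable (fun ω => |Y i ω - Y' i ω|) μ := ((iY i).sub (iY' i)).abs
  have hD0 : 0 ≤ D := Finset.sum_nonneg fun i _ => integral_nonneg fun ω => abs_nonneg _
  have hA0 : 0 ≤ A := Finset.sum_nonneg fun i _ => integral_nonneg fun ω => sq_nonneg _
  -- `X` and `X'` have the same constant sum `b`, so the difference of the sums of `Y` and `Y'`
  -- consists of approximation errors only.
  have hJ : ∫ ω, |∑ i, (Y i ω - Y' i ω)| ∂μ ≤ 2 * D := by
    have h1 : ∫ ω, |∑ i, (Y i ω - Y' i ω)| ∂μ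
        ≤ ∫ ω, (∑ i, |X i ω - Y i ω| + ∑ i, |X' i ω - Y' i ω|) ∂μ := by
      refine integral_mono (integrable_finsetSum _ fun i _ => (iY i).sub (iY' i)).abs
        ((integrable_finsetSum _ fun i _ => iXY i).add
          (integrable_finsetSum _ fun i _ => iXY' i)) fun ω => ?_
      have e : ∑ i, (Y i ω - Y' i ω)
          = ∑ i, (X' i ω - Y' i ω) - ∑ i, (X i ω - Y i ω) := by
        simp only [Finset.sum_sub_distrib, sX, sX']; ring
      show |∑ i, (Y i ω - Y' i ω)| ≤ ∑ i, |X i ω - Y i ω| + ∑ i, |X' i ω - Y' i ω|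
      rw [e]
      refine (abs_sub _ _).trans ?_
      rw [add_comm]
      exact add_le_add (Finset.abs_sum_le_sum_abs _ _) (Finset.abs_sum_le_sum_abs _ _)
    rw [integral_add (integrable_finsetSum _ fun i _ => iXY i)
      (integrable_finsetSum _ fun i _ => iXY' i), integral_finsetSum _ fun i _ => iXY i,
      integral_finsetSum _ fun i _ => iXY' i] at h1
    rw [← hD, ← hD'] at h1
    linarith
  have hAb : A ≤ 2 * (b + D) := by
    have hYs : ∑ i, ∫ ω, Y i ω ∂μ ≤ b + D := by
      rw [hD, ← integral_finsetSum _ fun i _ => iY i, ← integral_finsetSum _ fun i _ => iXY i]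
      have : (b : ℝ) = ∫ _, (b : ℝ) ∂μ := by simp
      rw [this, ← integral_add (integrable_const _) (integrable_finsetSum _ fun i _ => iXY i)]
      refine integral_mono (integrable_finsetSum _ fun i _ => iY i)
        ((integrable_const _).add (integrable_finsetSum _ fun i _ => iXY i)) fun ω => ?_
      show ∑ i, Y i ω ≤ b + ∑ i, |X i ω - Y i ω|
      rw [← sX ω, ← Finset.sum_add_distrib]
      exact Finset.sum_le_sum fun i _ => by linarith [neg_abs_le (X i ω - Y i ω)]
    have : A ≤ ∑ i, (∫ ω, Y i ω ∂μ + ∫ ω, Y' i ω ∂μ) := by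
      refine Finset.sum_le_sum fun i _ => ?_
      rw [← integral_add (iY i) (iY' i)]
      simp_rw [hsq]
      refine integral_mono (iYY' i) ((iY i).add (iY' i)) fun ω => ?_
      show |Y i ω - Y' i ω| ≤ Y i ω + Y' i ω
      rcases vY i ω with h | h <;> rcases vY' i ω with h' | h' <;> simp [h, h']
    refine this.trans ?_
    simp_rw [← hY]
    rw [Finset.sum_add_distrib]; linarith
  have hb1 : (1 : ℝ) ≤ b := by exact_mod_cast hb
  have hsb : (1 : ℝ) ≤ √b := Real.one_le_sqrt.2 hb1
  have hsb2 : √(b : ℝ) ^ 2 = b := Real.sq_sqrt (by positivity)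
  -- If `D ≥ √b`, then `b ≤ √b * D` and the bound `2 * (b + D)` suffices. Otherwise `A ≤ 4 * b`, so
  -- that `2 + 6 * A ≤ 26 * b ≤ (21 / 4 * √b) ^ 2`, and the moment inequality applies.
  have hfin : A ≤ 21 * √b * D := by
    rcases le_total (√(b : ℝ)) D with h | h
    · nlinarith
    · have hA4 : A ≤ 4 * b := by nlinarith
      have hK : √(2 + 6 * A) ≤ 21 / 4 * √b := by
        rw [Real.sqrt_le_iff]
        refine ⟨by positivity, ?_⟩
        rw [mul_pow, hsb2]; linarith
      calc A ≤ 2 * √(2 + 6 * A) * ∫ ω, |∑ i, (Y i ω - Y' i ω)| ∂μ := hA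
        _ ≤ 2 * (21 / 4 * √b) * (2 * D) := by gcongr
        _ = 21 * √b * D := by ring
  have : ∑ i, ∫ ω, |X i ω - Y' i ω| ∂μ ≤ D + A := by
    rw [hD, hAd, ← Finset.sum_add_distrib]
    refine Finset.sum_le_sum fun i _ => ?_
    simp_rw [hsq]
    rw [← integral_add (iXY i) (iYY' i)]
    exact integral_mono ((iX i).sub (iY' i)).abs ((iXY i).add (iYY' i)) fun ω =>
      abs_sub_le _ _ _
  linarith

end LocalModel

namespace LocalModel
open ProbabilityTheory

/-! ### Measure-theoretic preliminaries -/

/-- Ports and permutations range over finite types, so measurability may be checked with the random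
port or permutation frozen. -/
theorem measurable_of_index {X Y ι : Type*} [MeasurableSpace X] [MeasurableSpace Y]
    [MeasurableSpace ι] [Countable ι] [MeasurableSingletonClass ι] {f : ι → X → Y} {i : X → ι}
    (hi : Measurable i) (hf : ∀ k, Measurable (f k)) : Measurable fun x => f (i x) x :=
  (measurable_from_prod_countable_right (f := fun p : ι × X => f p.1 p.2) hf).comp
    (hi.prodMk measurable_id)

theorem measurableSet_not_iff {X : Type*} [MeasurableSpace X] {p q : X → Prop}
    (hp : MeasurableSet {x | p x}) (hq : MeasurableSet {x | q x}) :
    MeasurableSet {x | ¬ (p x ↔ q x)} :=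
  (measurableSet_setOfPred.2
    (Measurable.iff (measurableSet_setOfPred.1 hp) (measurableSet_setOfPred.1 hq))).compl

/-- The probability that two independent events do not agree. -/
theorem prod_not_iff {X Y : Type*} [MeasurableSpace X] [MeasurableSpace Y] (μ : Measure X)
    (κ : Measure Y) [SFinite μ] [SFinite κ] {S : Set X} {S' : Set Y} (hS : MeasurableSet S)
    (hS' : MeasurableSet S') :
    (μ.prod κ) {p | ¬ (p.1 ∈ S ↔ p.2 ∈ S')} = μ S * κ S'ᶜ + μ Sᶜ * κ S' := by
  have : {p : X × Y | ¬ (p.1 ∈ S ↔ p.2 ∈ S')} = S ×ˢ S'ᶜ ∪ Sᶜ ×ˢ S' := by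
    ext p; simp only [Set.mem_ofPred_eq, Set.mem_union, Set.mem_prod, Set.mem_compl_iff]; tauto
  rw [this, measure_union _ (hS.compl.prod hS'), Measure.prod_prod, Measure.prod_prod]
  rw [Set.disjoint_left]
  rintro p ⟨h, -⟩ ⟨h', -⟩
  exact h' h

theorem measurePreserving_prodProdProdComm {A B C D : Type*} [MeasurableSpace A]
    [MeasurableSpace B] [MeasurableSpace C] [MeasurableSpace D] (a : Measure A) (b : Measure B)
    (c : Measure C) (d : Measure D) [SFinite a] [SFinite b] [SFinite c] [SFinite d] :
    MeasurePreserving (fun p : (A × B) × (C × D) => ((p.1.1, p.2.1), (p.1.2, p.2.2)))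
      ((a.prod b).prod (c.prod d)) ((a.prod c).prod (b.prod d)) := by
  have h1 := measurePreserving_prodAssoc a b (c.prod d)
  have h2 : MeasurePreserving (fun p : B × (C × D) => (p.2.1, (p.1, p.2.2)))
      (b.prod (c.prod d)) (c.prod (b.prod d)) :=
    (measurePreserving_prodAssoc c b d).comp
      (((Measure.measurePreserving_swap (μ := b) (ν := c)).prod (MeasurePreserving.id d)).comp
        (measurePreserving_prodAssoc b c d).symm)
  exact (measurePreserving_prodAssoc a c (b.prod d)).symm.comp
    (((MeasurePreserving.id a).prod h2).comp h1)

/-- Resampling for a family of events that always has exactly `b` members. -/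
theorem sum_resampled_pi_le {E : Type*} [MeasurableSpace E] (ρ : Measure E)
    [IsProbabilityMeasure ρ] {n b : ℕ} (hb : 1 ≤ b) {F : Fin n → Set (Fin n → E)}
    (hF : ∀ i, MeasurableSet (F i)) (hcard : ∀ e, {i | e ∈ F i}.ncard = b)
    {Y : Fin n → Set E} (hY : ∀ i, MeasurableSet (Y i)) :
    ∑ i, ((Measure.pi fun _ : Fin n => ρ).prod ρ) {p | ¬ (p.1 ∈ F i ↔ p.2 ∈ Y i)} ≤
      ENNReal.ofReal (1 + 21 * √b) *
        ∑ i, (Measure.pi fun _ : Fin n => ρ) {e | ¬ (e ∈ F i ↔ e i ∈ Y i)} := by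
  classical
  -- Every coordinate is drawn twice. The first copies drive `X` and `Y`, the second ones `X'` and
  -- `Y'`; thus `X` and `Y' i` are independent, which gives the product measure of the left-hand
  -- side.
  set P : Measure (Fin n → E × E) := Measure.pi fun _ => ρ.prod ρ with hP
  set π := Measure.pi fun _ : Fin n => ρ with hπ
  have mfst : MeasurePreserving (fun (ω : Fin n → E × E) k => (ω k).1) P π :=
    measurePreserving_pi _ _ fun _ => measurePreserving_fst
  have msnd : MeasurePreserving (fun (ω : Fin n → E × E) k => (ω k).2) P π :=
    measurePreserving_pi _ _ fun _ => measurePreserving_snd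
  have mboth : ∀ i, MeasurePreserving (fun (ω : Fin n → E × E) => ((fun k => (ω k).1), (ω i).2))
      P (π.prod ρ) := fun i =>
    ((MeasurePreserving.id π).prod (measurePreserving_eval (fun _ : Fin n => ρ) i)).comp
      (measurePreserving_arrowProdEquivProdArrow E E (Fin n) (fun _ => ρ) fun _ => ρ)
  let ind : Prop → ℝ := fun p => if p then 1 else 0
  have vind : ∀ p, ind p = 0 ∨ ind p = 1 := fun p => by
    by_cases h : p <;> simp [ind, h]
  have mind : ∀ {α : Type _} [MeasurableSpace α] {S : Set α}, MeasurableSet S →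
      Measurable fun x => ind (x ∈ S) := fun hS => Measurable.ite hS measurable_const
        measurable_const
  have hxor : ∀ {p q : (Fin n → E × E) → Prop}, MeasurableSet {ω | p ω} → MeasurableSet {ω | q ω} →
      ∫ ω, |ind (p ω) - ind (q ω)| ∂P = P.real {ω | ¬ (p ω ↔ q ω)} := fun {p q} hp hq => by
    rw [← integral_indicator_one (measurableSet_not_iff hp hq)]
    congr 1; ext ω
    by_cases h : p ω <;> by_cases h' : q ω <;> simp [ind, h, h', Set.indicator]
  have hsum : ∀ e : Fin n → E, ∑ i, ind (e ∈ F i) = b := fun e => by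
    rw [← hcard e, Set.ncard_eq_toFinset_card']
    simp [ind]
  have mF1 : ∀ i, MeasurableSet {ω : Fin n → E × E | (fun k => (ω k).1) ∈ F i} := fun i =>
    mfst.measurable (hF i)
  have mF2 : ∀ i, MeasurableSet {ω : Fin n → E × E | (fun k => (ω k).2) ∈ F i} := fun i =>
    msnd.measurable (hF i)
  have mY1 : ∀ i, MeasurableSet {ω : Fin n → E × E | (ω i).1 ∈ Y i} := fun i =>
    (measurable_fst.comp (measurable_pi_apply i)) (hY i)
  have mY2 : ∀ i, MeasurableSet {ω : Fin n → E × E | (ω i).2 ∈ Y i} := fun i =>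
    (measurable_snd.comp (measurable_pi_apply i)) (hY i)
  have msF : ∀ i, MeasurableSet {e : Fin n → E | ¬ (e ∈ F i ↔ e i ∈ Y i)} := fun i =>
    measurableSet_not_iff (hF i) ((measurable_pi_apply i) (hY i))
  have e1 : ∀ i, ∫ ω, |ind ((fun k => (ω k).1) ∈ F i) - ind ((ω i).1 ∈ Y i)| ∂P
      = π.real {e | ¬ (e ∈ F i ↔ e i ∈ Y i)} := fun i => by
    rw [hxor (mF1 i) (mY1 i)]
    exact mfst.measureReal_preimage (msF i).nullMeasurableSet
  have e2 : ∀ i, ∫ ω, |ind ((fun k => (ω k).2) ∈ F i) - ind ((ω i).2 ∈ Y i)| ∂P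
      = π.real {e | ¬ (e ∈ F i ↔ e i ∈ Y i)} := fun i => by
    rw [hxor (mF2 i) (mY2 i)]
    exact msnd.measureReal_preimage (msF i).nullMeasurableSet
  have e3 : ∀ i, ∫ ω, |ind ((fun k => (ω k).1) ∈ F i) - ind ((ω i).2 ∈ Y i)| ∂P
      = (π.prod ρ).real {p | ¬ (p.1 ∈ F i ↔ p.2 ∈ Y i)} := fun i => by
    rw [hxor (mF1 i) (mY2 i)]
    exact (mboth i).measureReal_preimage
      (measurableSet_not_iff (measurable_fst (hF i)) (measurable_snd (hY i))).nullMeasurableSet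
  have hmean : ∀ i, ∫ ω, ind ((ω i).1 ∈ Y i) ∂P = ∫ ω, ind ((ω i).2 ∈ Y i) ∂P := fun i => by
    have h1 : ∫ ω, ind ((ω i).1 ∈ Y i) ∂P = ∫ x, ind (x.1 ∈ Y i) ∂(ρ.prod ρ) :=
      ((measurePreserving_eval (fun _ : Fin n => ρ.prod ρ) i).map_eq ▸
        integral_map (measurable_pi_apply i).aemeasurable
          (mind (measurable_fst (hY i))).aestronglyMeasurable).symm
    have h2 : ∫ ω, ind ((ω i).2 ∈ Y i) ∂P = ∫ x, ind (x.2 ∈ Y i) ∂(ρ.prod ρ) :=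
      ((measurePreserving_eval (fun _ : Fin n => ρ.prod ρ) i).map_eq ▸
        integral_map (measurable_pi_apply i).aemeasurable
          (mind (measurable_snd (hY i))).aestronglyMeasurable).symm
    rw [h1, h2]
    exact (integral_prod_swap (μ := ρ) (ν := ρ) (fun x : E × E => ind (x.2 ∈ Y i)))
  have main := sum_resampled_le (μ := P) (X := fun i ω => ind ((fun k => (ω k).1) ∈ F i))
    (Y := fun i ω => ind ((ω i).1 ∈ Y i)) (X' := fun i ω => ind ((fun k => (ω k).2) ∈ F i))
    (Y' := fun i ω => ind ((ω i).2 ∈ Y i)) hb (fun i => mind (mF1 i)) (fun i => mind (mY1 i))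
    (fun i => mind (mF2 i)) (fun i => mind (mY2 i)) (fun _ _ => vind _) (fun _ _ => vind _)
    (fun _ _ => vind _) (fun _ _ => vind _) (fun _ => hsum _) (fun _ => hsum _)
    (iIndepFun_pi (μ := fun _ : Fin n => ρ.prod ρ)
      (X := fun i x => ind (x.1 ∈ Y i) - ind (x.2 ∈ Y i)) fun i =>
        ((mind (measurable_fst (hY i))).sub (mind (measurable_snd (hY i)))).aemeasurable)
    hmean (fun i => (e1 i).trans (e2 i).symm)
  simp only [e1, e3] at main
  have := ENNReal.ofReal_le_ofReal main
  rwa [ENNReal.ofReal_mul (by positivity), ENNReal.ofReal_sum_of_nonneg fun _ _ => measureReal_nonneg,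
    ENNReal.ofReal_sum_of_nonneg fun _ _ => measureReal_nonneg, Finset.sum_congr rfl fun i _ =>
      ofReal_measureReal, Finset.sum_congr (s₁ := Finset.univ) rfl fun i _ =>
      ofReal_measureReal] at this

/-! ### The random port-numbered tree -/

/-- The uniform distribution on the ports. -/
noncomputable def portMeasure (m : ℕ) : Measure (Fin (m + 1)) :=
  (PMF.uniformOfFintype (Fin (m + 1))).toMeasure

instance (m : ℕ) : IsProbabilityMeasure (portMeasure m) := by
  unfold portMeasure; infer_instance

theorem lintegral_portMeasure (m : ℕ) (f : Fin (m + 1) → ENNReal) :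
    ∫⁻ i, f i ∂portMeasure m = (m + 1 : ENNReal)⁻¹ * ∑ i, f i := by
  rw [lintegral_fintype, Finset.mul_sum]
  refine Finset.sum_congr rfl fun i _ => ?_
  rw [portMeasure, PMF.toMeasure_apply_singleton _ _ (measurableSet_singleton _)]
  simp [mul_comm]

/-- What a node knows about the part of an `(m + 1)`-regular tree that lies behind one of its ports,
up to distance `t`: the randomness of the neighbor, the number of the port of the neighbor that
leads back, and the branches behind the other ports of the neighbor. -/
def Branch (R : Type) (m : ℕ) : ℕ → Type
  | 0 => Unit
  | t + 1 => (R × Fin (m + 1)) × (Fin m → Branch R m t)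

variable {R : Type} {m : ℕ}

instance Branch.measurableSpace [MeasurableSpace R] : ∀ t, MeasurableSpace (Branch R m t)
  | 0 => inferInstanceAs (MeasurableSpace Unit)
  | t + 1 =>
    haveI : MeasurableSpace (Branch R m t) := Branch.measurableSpace t
    inferInstanceAs (MeasurableSpace ((R × Fin (m + 1)) × (Fin m → Branch R m t)))

/-- The law of a random branch. -/
noncomputable def branchMeasure [MeasurableSpace R] (ν : Measure R) (m : ℕ) :
    ∀ t, Measure (Branch R m t)
  | 0 => (Measure.dirac () : Measure Unit)
  | t + 1 => (((ν.prod (portMeasure m)).prod (Measure.pi fun _ : Fin m => branchMeasure ν m t)) :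
      Measure ((R × Fin (m + 1)) × (Fin m → Branch R m t)))

instance [MeasurableSpace R] (ν : Measure R) [IsProbabilityMeasure ν] (t : ℕ) :
    IsProbabilityMeasure (branchMeasure ν m t) := by
  induction t with
  | zero => exact inferInstanceAs (IsProbabilityMeasure (Measure.dirac ()))
  | succ t ih =>
    exact inferInstanceAs (IsProbabilityMeasure
      ((ν.prod (portMeasure m)).prod (Measure.pi fun _ : Fin m => branchMeasure ν m t)))

/-- A branch as a triple. -/
abbrev Branch.Unfolded (R : Type) (m t : ℕ) : Type := (R × Fin (m + 1)) × (Fin m → Branch R m t)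

/-- Forget the last level of a branch. -/
def Branch.trunc : ∀ {t : ℕ}, Branch R m (t + 1) → Branch R m t
  | 0, _ => ()
  | _ + 1, γ => (γ.1, fun j => Branch.trunc (γ.2 j))

/-- Replace all levels but the last one. -/
def Branch.graft : ∀ {t : ℕ}, Branch R m t → Branch R m (t + 1) → Branch R m (t + 1)
  | 0, _, e => e
  | _ + 1, γ, e => (γ.1, fun j => Branch.graft (γ.2 j) (e.2 j))

theorem Branch.trunc_graft : ∀ {t : ℕ} (γ : Branch R m t) (e : Branch R m (t + 1)),
    (γ.graft e).trunc = γ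
  | 0, _, _ => rfl
  | _ + 1, γ, e => by
    show (γ.1, fun j => ((γ.2 j).graft (e.2 j)).trunc) = γ
    simp only [Branch.trunc_graft]
    rfl

variable [MeasurableSpace R]

theorem Branch.measurable_trunc : ∀ t, Measurable (Branch.trunc : Branch R m (t + 1) → Branch R m t)
  | 0 => measurable_const
  | t + 1 => by
    refine Measurable.prodMk (measurable_fst (α := R × Fin (m + 1))
      (β := Fin m → Branch R m (t + 1))) (measurable_pi_lambda _ fun j => ?_)
    exact (Branch.measurable_trunc t).comp ((measurable_pi_apply j).comp
      (measurable_snd (α := R × Fin (m + 1)) (β := Fin m → Branch R m (t + 1))))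

/-- The data at different nodes of a branch are independent. A whole independent branch can
therefore serve as the reservoir for one more level, its upper levels being ignored. -/
theorem Branch.measurePreserving_graft (ν : Measure R) [IsProbabilityMeasure ν] : ∀ t,
    MeasurePreserving (fun p : Branch R m t × Branch R m (t + 1) => p.1.graft p.2)
      ((branchMeasure ν m t).prod (branchMeasure ν m (t + 1))) (branchMeasure ν m (t + 1))
  | 0 => measurePreserving_snd
  | t + 1 => by
    have ih := Branch.measurePreserving_graft ν t
    set a := ν.prod (portMeasure m)
    set c := Measure.pi fun _ : Fin m => branchMeasure ν m t
    set c' := Measure.pi fun _ : Fin m => branchMeasure ν m (t + 1)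
    have h1 : MeasurePreserving (fun p : Branch.Unfolded R m t × Branch.Unfolded R m (t + 1) =>
        (p.1.1, (p.1.2, p.2.2))) ((a.prod c).prod (a.prod c')) (a.prod (c.prod c')) :=
      (measurePreserving_prodAssoc a c c').comp
        ((MeasurePreserving.id (a.prod c)).prod measurePreserving_snd)
    have h2 : MeasurePreserving (fun p : (Fin m → Branch R m t) × (Fin m → Branch R m (t + 1)) =>
        fun j => (p.1 j).graft (p.2 j)) (c.prod c') c' :=
      (measurePreserving_pi _ _ fun _ => ih).comp
        (measurePreserving_arrowProdEquivProdArrow (Branch R m t) (Branch R m (t + 1)) (Fin m)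
          (fun _ => branchMeasure ν m t) fun _ => branchMeasure ν m (t + 1)).symm
    exact ((MeasurePreserving.id a).prod h2).comp h1

/-- What a node knows after `t` rounds. -/
abbrev View (R : Type) (m t : ℕ) : Type := R × (Fin (m + 1) → Branch R m t)

/-- The view of the root of a branch, given the branch on the other side of its port. -/
def nodeView {t : ℕ} (γ : Branch R m (t + 1)) (β : Branch R m t) : View R m t :=
  (γ.1.1, (γ.1.2.insertNth β γ.2 : Fin (m + 1) → Branch R m t))

theorem measurable_insertNth {E : Type*} [MeasurableSpace E] (i : Fin (m + 1)) :
    Measurable fun p : E × (Fin m → E) => (i.insertNth p.1 p.2 : Fin (m + 1) → E) :=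
  (MeasurableEquiv.piFinSuccAbove (fun _ : Fin (m + 1) => E) i).symm.measurable

theorem measurable_nodeView {t : ℕ} :
    Measurable fun p : Branch.Unfolded R m t × Branch R m t =>
      nodeView (R := R) (m := m) (t := t) p.1 p.2 := by
  refine Measurable.prodMk (measurable_fst.comp (measurable_fst.comp measurable_fst)) ?_
  exact measurable_of_index
    (f := fun i (p : Branch.Unfolded R m t × Branch R m t) =>
      (i.insertNth p.2 p.1.2 : Fin (m + 1) → Branch R m t)) 
    (measurable_snd.comp (measurable_fst.comp measurable_fst)) fun i =>
      (measurable_insertNth i).comp (measurable_snd.prodMk (measurable_snd.comp measurable_fst))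

/-- Cutting a view with a distinguished port at that port, and adding one more level on the other
side. -/
theorem measurePreserving_cut (ν : Measure R) [IsProbabilityMeasure ν] (t : ℕ) :
    MeasurePreserving
      (fun p : ((R × Fin (m + 1)) × (Fin (m + 1) → Branch R m t)) × Branch R m (t + 1) =>
        (((p.1.1, p.1.1.2.removeNth p.1.2),
          (p.1.2 p.1.1.2).graft p.2) : Branch R m (t + 1) × Branch R m (t + 1)))
      (((ν.prod (portMeasure m)).prod (Measure.pi fun _ : Fin (m + 1) => branchMeasure ν m t)).prod
        (branchMeasure ν m (t + 1)))
      ((branchMeasure ν m (t + 1)).prod (branchMeasure ν m (t + 1))) := by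
  set a := ν.prod (portMeasure m)
  set ρ := branchMeasure ν m t
  set c := Measure.pi fun _ : Fin m => ρ
  set ρ' := branchMeasure ν m (t + 1)
  have h1 : MeasurePreserving (fun p : (R × Fin (m + 1)) × (Fin (m + 1) → Branch R m t) =>
      (p.1, (p.2 p.1.2, p.1.2.removeNth p.2)))
      (a.prod (Measure.pi fun _ : Fin (m + 1) => ρ)) (a.prod (ρ.prod c)) := by
    refine MeasurePreserving.skew_product (f := id)
      (g := fun x (c : Fin (m + 1) → Branch R m t) => (c x.2, x.2.removeNth c))
      (MeasurePreserving.id a) ?_ (Filter.Eventually.of_forall fun x => ?_)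
    · exact measurable_of_index (f := fun i (p : (R × Fin (m + 1)) × (Fin (m + 1) → Branch R m t)) =>
        (p.2 i, i.removeNth p.2)) (by fun_prop) fun i =>
        (MeasurableEquiv.piFinSuccAbove (fun _ : Fin (m + 1) => Branch R m t) i).measurable.comp
          measurable_snd
    · exact (measurePreserving_piFinSuccAbove (fun _ : Fin (m + 1) => ρ) x.2).map_eq
  have h2 : MeasurePreserving (fun p : (R × Fin (m + 1)) × (Branch R m t × (Fin m → Branch R m t)) =>
      ((p.1, p.2.2), p.2.1)) (a.prod (ρ.prod c)) ((a.prod c).prod ρ) :=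
    (measurePreserving_prodAssoc a c ρ).symm.comp
      ((MeasurePreserving.id a).prod Measure.measurePreserving_swap)
  have h3 := (MeasurePreserving.id (a.prod c)).prod (Branch.measurePreserving_graft (m := m) ν t)
  exact (h3.comp (measurePreserving_prodAssoc (a.prod c) ρ ρ')).comp
    ((h2.comp h1).prod (MeasurePreserving.id ρ'))

/-- Turns a uniform port into a sum over all ports of one node, the form in which the condition of
exactly `b` selected ports can be used. -/
theorem lintegral_port {C : Type*} [MeasurableSpace C] (ν : Measure R) [IsProbabilityMeasure ν]
    (κ : Measure C) [SFinite κ] {H : (R × Fin (m + 1)) × C → ENNReal} (hH : Measurable H) :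
    ∫⁻ p, H p ∂((ν.prod (portMeasure m)).prod κ)
      = ∫⁻ c, ∫⁻ r, (m + 1 : ENNReal)⁻¹ * ∑ i, H ((r, i), c) ∂ν ∂κ := by
  rw [lintegral_prod_symm' _ hH]
  refine lintegral_congr fun c => ?_
  have hc : Measurable fun x : R × Fin (m + 1) => H (x, c) :=
    hH.comp (measurable_id.prodMk measurable_const)
  rw [lintegral_prod _ hc.aemeasurable]
  exact lintegral_congr fun r => lintegral_portMeasure m _

end LocalModel

namespace LocalModel
open ProbabilityTheory

variable {R : Type} {m : ℕ} [MeasurableSpace R]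

/-! ### Round elimination on the tree -/

/-- The pairs of branches behind the two ends of an edge for which the first end of the edge is
selected by `F`. -/
def grabSet {t : ℕ} (F : Fin (m + 1) → Set (View R m t)) :
    Set (Branch R m (t + 1) × Branch R m (t + 1)) :=
  {p | nodeView p.1 p.2.trunc ∈ F p.1.1.2}

/-- The probability that a random edge of the tree is selected by exactly one of its ends. -/
noncomputable def mismatch (ν : Measure R) {t : ℕ} (F : Fin (m + 1) → Set (View R m t)) : ENNReal :=
  ((branchMeasure ν m (t + 1)).prod (branchMeasure ν m (t + 1)))
    {p | ¬ (p ∈ grabSet F ↔ p.swap ∈ grabSet F)}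

theorem measurableSet_indexed {X : Type*} [MeasurableSpace X] {i : X → Fin (m + 1)}
    (hi : Measurable i) {S : Fin (m + 1) → Set X} (hS : ∀ k, MeasurableSet (S k)) :
    MeasurableSet {x | x ∈ S (i x)} :=
  measurableSet_setOfPred.2
    (measurable_of_index (f := fun k x => x ∈ S k) hi fun k => measurableSet_setOfPred.1 (hS k))

theorem measurableSet_grabSet {t : ℕ} {F : Fin (m + 1) → Set (View R m t)}
    (hF : ∀ i, MeasurableSet (F i)) : MeasurableSet (grabSet F) := by
  have h : Measurable fun p : Branch.Unfolded R m t × Branch R m (t + 1) =>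
      nodeView (R := R) (m := m) (t := t) p.1 p.2.trunc :=
    measurable_nodeView.comp
      (measurable_fst.prodMk ((Branch.measurable_trunc t).comp measurable_snd))
  exact measurableSet_indexed
    (i := fun p : Branch.Unfolded R m t × Branch R m (t + 1) => p.1.1.2)
    (measurable_snd.comp (measurable_fst.comp measurable_fst)) fun k => h (hF k)

/-- The right-hand side is a weighted mean of `x` and `x'`. Whatever the other end does, the chance
of a disagreement is at least the chance of an unlikely decision. -/
theorem xor_bound {x x' y y' : ENNReal} (hy : y + y' = 1) :
    min x x' ≤ x * y' + x' * y := by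
  calc min x x' = min x x' * y' + min x x' * y := by rw [← mul_add, add_comm y', hy, mul_one]
    _ ≤ x * y' + x' * y := by gcongr <;> simp

/-- In real terms `1 - 2 * (x * y' + x' * y) = (1 - 2 * x) * (1 - 2 * y)`, and the two factors have
opposite signs. -/
theorem half_le_xor {x x' y y' : ENNReal} (hx : x + x' = 1) (hy : y + y' = 1) (h1 : 2⁻¹ ≤ x)
    (h2 : y ≤ 2⁻¹) : 1 ≤ 2 * (x * y' + x' * y) := by
  have fin : ∀ {a b : ENNReal}, a + b = 1 → a ≠ ⊤ ∧ b ≠ ⊤ := fun h => by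
    have := h ▸ ENNReal.one_ne_top
    exact ENNReal.add_ne_top.1 this
  lift x to NNReal using (fin hx).1
  lift x' to NNReal using (fin hx).2
  lift y to NNReal using (fin hy).1
  lift y' to NNReal using (fin hy).2
  have e : (2⁻¹ : ENNReal) = ((2⁻¹ : NNReal) : ENNReal) := by simp
  rw [e] at h1 h2
  norm_cast at *
  rw [← NNReal.coe_le_coe] at *
  have hx := congrArg NNReal.toReal hx
  have hy := congrArg NNReal.toReal hy
  push_cast at *
  nlinarith

/-- The values of the `i`-th coordinate given which an event has probability at least `1 / 2`. -/
def likely {E : Type*} [MeasurableSpace E] (ρ : Measure E) (S : Set (Fin (m + 1) → E))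
    (i : Fin (m + 1)) : Set E :=
  {ε | 2⁻¹ ≤ (Measure.pi fun _ : Fin m => ρ) {e | (i.insertNth ε e : Fin (m + 1) → E) ∈ S}}

theorem measurableSet_likely {E : Type*} [MeasurableSpace E] (ρ : Measure E)
    [IsProbabilityMeasure ρ] {S : Set (Fin (m + 1) → E)} (hS : MeasurableSet S) (i : Fin (m + 1)) :
    MeasurableSet (likely ρ S i) :=
  measurableSet_le measurable_const (measurable_measure_prodMk_left (measurable_insertNth i hS))

/-- Given the `i`-th coordinate, guessing the more likely outcome errs with the smaller of the two
conditional probabilities. -/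
theorem not_iff_likely_le {E : Type*} [MeasurableSpace E] (ρ : Measure E)
    [IsProbabilityMeasure ρ] {S : Set (Fin (m + 1) → E)} (hS : MeasurableSet S)
    (i : Fin (m + 1)) :
    (Measure.pi fun _ : Fin (m + 1) => ρ) {e | ¬ (e ∈ S ↔ e i ∈ likely ρ S i)} ≤
      ∫⁻ ε, min ((Measure.pi fun _ : Fin m => ρ) {e | (i.insertNth ε e : Fin (m + 1) → E) ∈ S})
        ((Measure.pi fun _ : Fin m => ρ) {e | (i.insertNth ε e : Fin (m + 1) → E) ∈ S}ᶜ) ∂ρ := by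
  have hm : MeasurableSet {e : Fin (m + 1) → E | ¬ (e ∈ S ↔ e i ∈ likely ρ S i)} :=
    measurableSet_not_iff hS ((measurable_pi_apply i) (measurableSet_likely ρ hS i))
  rw [← ((measurePreserving_piFinSuccAbove (fun _ : Fin (m + 1) => ρ) i).symm).measure_preimage
    hm.nullMeasurableSet, Measure.prod_apply (MeasurableEquiv.measurable _ hm)]
  refine lintegral_mono fun ε => ?_
  set Q := {e : Fin m → E | (i.insertNth ε e : Fin (m + 1) → E) ∈ S} with hQ
  have hQm : MeasurableSet Q := (measurable_insertNth i).comp measurable_prodMk_left hS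
  have hsum := prob_add_prob_compl (μ := Measure.pi fun _ : Fin m => ρ) hQm
  have hpre : Prod.mk ε ⁻¹' ((MeasurableEquiv.piFinSuccAbove (fun _ : Fin (m + 1) => E) i).symm ⁻¹'
      {e | ¬ (e ∈ S ↔ e i ∈ likely ρ S i)}) = {e | ¬ (e ∈ Q ↔ ε ∈ likely ρ S i)} := by
    ext e
    simp [MeasurableEquiv.piFinSuccAbove, Fin.insertNthEquiv, hQ]
  rw [hpre]
  by_cases h : ε ∈ likely ρ S i
  · have e1 : {e | ¬ (e ∈ Q ↔ ε ∈ likely ρ S i)} = Qᶜ := by ext e; simp [h]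
    have h' : 2⁻¹ ≤ (Measure.pi fun _ : Fin m => ρ) Q := h
    rw [e1]
    refine le_min ?_ le_rfl
    rw [prob_compl_eq_one_sub hQm]
    refine (tsub_le_tsub_left h' 1).trans ?_
    rwa [ENNReal.one_sub_inv_two]
  · have e1 : {e | ¬ (e ∈ Q ↔ ε ∈ likely ρ S i)} = Q := by ext e; simp [h]
    have h' : (Measure.pi fun _ : Fin m => ρ) Q < 2⁻¹ := not_le.1 h
    rw [e1]
    refine le_min le_rfl ?_
    rw [prob_compl_eq_one_sub hQm]
    refine h'.le.trans ?_
    rw [← ENNReal.one_sub_inv_two]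
    exact tsub_le_tsub_left h'.le 1

/-- The view of the root of a branch in which the last level behind the other ports is replaced. -/
def halfView {t : ℕ} (γ γ' : Branch R m (t + 1)) (e : Fin m → Branch R m (t + 1)) :
    View R m (t + 1) :=
  (γ.1.1, (γ.1.2.insertNth γ' fun k => (γ.2 k).graft (e k) : Fin (m + 1) → Branch R m (t + 1)))

/-- The probability that the first end selects an edge, given the branches of depth `t + 1` on both
sides of it. -/
noncomputable def grabProb (ν : Measure R) {t : ℕ} (F : Fin (m + 1) → Set (View R m (t + 1)))
    (p : Branch R m (t + 1) × Branch R m (t + 1)) : ENNReal :=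
  (Measure.pi fun _ : Fin m => branchMeasure ν m (t + 1)) {e | halfView p.1 p.2 e ∈ F p.1.1.2}

noncomputable def grabProbCompl (ν : Measure R) {t : ℕ} (F : Fin (m + 1) → Set (View R m (t + 1)))
    (p : Branch R m (t + 1) × Branch R m (t + 1)) : ENNReal :=
  (Measure.pi fun _ : Fin m => branchMeasure ν m (t + 1)) {e | halfView p.1 p.2 e ∈ F p.1.1.2}ᶜ

variable (ν : Measure R) [IsProbabilityMeasure ν] {t : ℕ}

theorem measurable_graft_pi {X : Type*} [MeasurableSpace X] {k : ℕ} {f : X → Fin k → Branch R m t}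
    {g : X → Fin k → Branch R m (t + 1)} (hf : Measurable f) (hg : Measurable g) :
    Measurable fun x j => (f x j).graft (g x j) := by
  -- Measurability of `graft` is read off from its measure preservation, which needs some
  -- probability measure on `R`; a Dirac measure exists unless `R` is empty.
  by_cases hR : Nonempty R
  · obtain ⟨r⟩ := hR
    exact measurable_pi_lambda _ fun j =>
      (Branch.measurePreserving_graft (m := m) (Measure.dirac r) t).measurable.comp
        (((measurable_pi_apply j).comp hf).prodMk ((measurable_pi_apply j).comp hg))
  · have : IsEmpty R := not_nonempty_iff.1 hR
    refine measurable_pi_lambda _ fun j => ?_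
    have : IsEmpty (Branch R m (t + 1)) := ⟨fun b => isEmptyElim (b.1.1 : R)⟩
    have : IsEmpty X := ⟨fun x => isEmptyElim (g x j)⟩
    exact measurable_of_empty _

theorem measurableSet_halfView {F : Fin (m + 1) → Set (View R m (t + 1))}
    (hF : ∀ i, MeasurableSet (F i)) :
    MeasurableSet {x : (Branch R m (t + 1) × Branch R m (t + 1)) × (Fin m → Branch R m (t + 1)) |
      halfView x.1.1 x.1.2 x.2 ∈ F x.1.1.1.2} := by
  have hu : Measurable fun x : (Branch.Unfolded R m t × Branch R m (t + 1)) ×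
      (Fin m → Branch R m (t + 1)) => x.1.1 := measurable_fst.comp measurable_fst
  have hport : Measurable fun x : (Branch.Unfolded R m t × Branch R m (t + 1)) ×
      (Fin m → Branch R m (t + 1)) => x.1.1.1.2 := measurable_snd.comp (measurable_fst.comp hu)
  have h : Measurable fun x : (Branch.Unfolded R m t × Branch R m (t + 1)) ×
      (Fin m → Branch R m (t + 1)) =>
      halfView (R := R) (m := m) (t := t) x.1.1 x.1.2 x.2 := by
    refine Measurable.prodMk (measurable_fst.comp (measurable_fst.comp hu)) ?_
    exact measurable_of_index
      (f := fun i (x : (Branch.Unfolded R m t × Branch R m (t + 1)) ×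
        (Fin m → Branch R m (t + 1))) =>
        (i.insertNth x.1.2 fun k => (x.1.1.2 k).graft (x.2 k) :
          Fin (m + 1) → Branch R m (t + 1))) hport fun i =>
        (measurable_insertNth i).comp ((measurable_snd.comp measurable_fst).prodMk
          (measurable_graft_pi (measurable_snd.comp hu) measurable_snd))
  exact measurableSet_indexed hport fun k => h (hF k)

theorem measurableSet_halfView_slice {F : Fin (m + 1) → Set (View R m (t + 1))}
    (hF : ∀ i, MeasurableSet (F i)) (p : Branch R m (t + 1) × Branch R m (t + 1)) :
    MeasurableSet {e : Fin m → Branch R m (t + 1) | halfView p.1 p.2 e ∈ F p.1.1.2} :=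
  measurable_prodMk_left (x := p) (measurableSet_halfView hF)

theorem measurable_grabProb {F : Fin (m + 1) → Set (View R m (t + 1))}
    (hF : ∀ i, MeasurableSet (F i)) : Measurable (grabProb ν F) :=
  measurable_measure_prodMk_left (measurableSet_halfView hF)

theorem measurable_grabProbCompl {F : Fin (m + 1) → Set (View R m (t + 1))}
    (hF : ∀ i, MeasurableSet (F i)) : Measurable (grabProbCompl ν F) :=
  measurable_measure_prodMk_left (measurableSet_halfView hF).compl

theorem grabProb_add_compl {F : Fin (m + 1) → Set (View R m (t + 1))}
    (hF : ∀ i, MeasurableSet (F i)) (p : Branch R m (t + 1) × Branch R m (t + 1)) :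
    grabProb ν F p + grabProbCompl ν F p = 1 :=
  prob_add_prob_compl (measurableSet_halfView_slice hF p)

/-- Splits a branch of depth `t + 2` into its part of depth `t + 1`, on which one conditions, and
independent randomness for the last level. -/
theorem measurePreserving_extend :
    MeasurePreserving (fun x : Branch R m (t + 1) × (Fin m → Branch R m (t + 1)) =>
        ((x.1.1, fun k => (x.1.2 k).graft (x.2 k)) : Branch R m (t + 1 + 1)))
      ((branchMeasure ν m (t + 1)).prod (Measure.pi fun _ : Fin m => branchMeasure ν m (t + 1)))
      (branchMeasure ν m (t + 1 + 1)) := by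
  set a := ν.prod (portMeasure m)
  set c := Measure.pi fun _ : Fin m => branchMeasure ν m t
  set c' := Measure.pi fun _ : Fin m => branchMeasure ν m (t + 1)
  have h2 : MeasurePreserving (fun p : (Fin m → Branch R m t) × (Fin m → Branch R m (t + 1)) =>
      fun j => (p.1 j).graft (p.2 j)) (c.prod c') c' :=
    (measurePreserving_pi _ _ fun _ => Branch.measurePreserving_graft ν t).comp
      (measurePreserving_arrowProdEquivProdArrow (Branch R m t) (Branch R m (t + 1)) (Fin m)
        (fun _ => branchMeasure ν m t) fun _ => branchMeasure ν m (t + 1)).symm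
  exact ((MeasurePreserving.id a).prod h2).comp (measurePreserving_prodAssoc a c c')

omit [MeasurableSpace R] in
theorem trunc_extend (γ : Branch R m (t + 1)) (e : Fin m → Branch R m (t + 1)) :
    Branch.trunc ((γ.1, fun k => (γ.2 k).graft (e k)) : Branch R m (t + 1 + 1)) = γ := by
  show (γ.1, fun k => ((γ.2 k).graft (e k)).trunc) = γ
  simp only [Branch.trunc_graft]
  rfl

/-- Given the branches of depth `t + 1` on both sides of an edge, the decisions of its two ends are
independent. -/
theorem mismatch_eq {F : Fin (m + 1) → Set (View R m (t + 1))} (hF : ∀ i, MeasurableSet (F i)) :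
    mismatch ν F = ∫⁻ p, (grabProb ν F p * grabProbCompl ν F p.swap +
      grabProbCompl ν F p * grabProb ν F p.swap)
        ∂((branchMeasure ν m (t + 1)).prod (branchMeasure ν m (t + 1))) := by
  set ρ := branchMeasure ν m (t + 1)
  set π := Measure.pi fun _ : Fin m => ρ
  have hM := ((measurePreserving_extend (m := m) (t := t) ν).prod
    (measurePreserving_extend (m := m) (t := t) ν)).comp
    (measurePreserving_prodProdProdComm ρ ρ π π)
  have hS : MeasurableSet {p | ¬ (p ∈ grabSet F ↔ p.swap ∈ grabSet F)} :=
    measurableSet_not_iff (measurableSet_grabSet hF) (measurable_swap (measurableSet_grabSet hF))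
  refine (hM.measure_preimage hS.nullMeasurableSet).symm.trans ?_
  rw [Measure.prod_apply (hM.measurable hS)]
  refine lintegral_congr fun p => ?_
  have := prod_not_iff π π (measurableSet_halfView_slice hF p)
    (measurableSet_halfView_slice hF p.swap)
  refine Eq.trans (congrArg _ ?_) this
  ext e
  have key : ∀ (γ γ' : Branch R m (t + 1)) (e e' : Fin m → Branch R m (t + 1)),
      ((((γ.1, fun k => (γ.2 k).graft (e k)) : Branch R m (t + 1 + 1)),
        ((γ'.1, fun k => (γ'.2 k).graft (e' k)) : Branch R m (t + 1 + 1))) ∈ grabSet F) ↔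
        halfView γ γ' e ∈ F γ.1.2 := fun γ γ' e e' => by
    show nodeView _ (Branch.trunc _) ∈ F _ ↔ _
    rw [trunc_extend]; rfl
  exact not_congr (iff_congr (key p.1 p.2 e.1 e.2) (key p.2 p.1 e.2 e.1))

/-- Simulate the last round with given randomness. -/
def simulate (F : Fin (m + 1) → Set (View R m (t + 1))) (e : Fin (m + 1) → Branch R m (t + 1))
    (i : Fin (m + 1)) : Set (View R m t) :=
  {q | (q.1, fun k => (q.2 k).graft (e k)) ∈ F i}

theorem measurableSet_simulate_uncurry {F : Fin (m + 1) → Set (View R m (t + 1))}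
    (hF : ∀ i, MeasurableSet (F i)) (i : Fin (m + 1)) :
    MeasurableSet {x : View R m t × (Fin (m + 1) → Branch R m (t + 1)) |
      x.1 ∈ simulate F x.2 i} := by
  have : Measurable fun x : View R m t × (Fin (m + 1) → Branch R m (t + 1)) =>
      ((x.1.1, fun k => (x.1.2 k).graft (x.2 k)) : View R m (t + 1)) :=
    (measurable_fst.comp measurable_fst).prodMk
      (measurable_graft_pi (measurable_snd.comp measurable_fst) measurable_snd)
  exact this (hF i)

theorem measurableSet_simulate {F : Fin (m + 1) → Set (View R m (t + 1))}
    (hF : ∀ i, MeasurableSet (F i)) (e : Fin (m + 1) → Branch R m (t + 1)) (i : Fin (m + 1)) :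
    MeasurableSet (simulate F e i) :=
  measurable_prodMk_right (y := e) (measurableSet_simulate_uncurry hF i)

theorem measurableSet_grabSet_simulate {F : Fin (m + 1) → Set (View R m (t + 1))}
    (hF : ∀ i, MeasurableSet (F i)) :
    MeasurableSet {x : (Branch R m (t + 1) × Branch R m (t + 1)) ×
      (Fin (m + 1) → Branch R m (t + 1)) | x.1 ∈ grabSet (simulate F x.2)} := by
  have h : Measurable fun x : (Branch.Unfolded R m t × Branch R m (t + 1)) ×
      (Fin (m + 1) → Branch R m (t + 1)) =>
      (nodeView (R := R) (m := m) (t := t) x.1.1 x.1.2.trunc, x.2) :=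
    (measurable_nodeView.comp ((measurable_fst.comp measurable_fst).prodMk
      ((Branch.measurable_trunc t).comp (measurable_snd.comp measurable_fst)))).prodMk
      measurable_snd
  exact measurableSet_indexed
    (i := fun x : (Branch.Unfolded R m t × Branch R m (t + 1)) ×
      (Fin (m + 1) → Branch R m (t + 1)) => x.1.1.1.2)
    (measurable_snd.comp (measurable_fst.comp (measurable_fst.comp measurable_fst)))
    fun k => h (measurableSet_simulate_uncurry hF k)

omit [MeasurableSpace R] in
theorem nodeView_cut (r : R) (i : Fin (m + 1)) (c : Fin (m + 1) → Branch R m t)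
    (ε : Branch R m (t + 1)) :
    nodeView (t := t) (((r, i), i.removeNth c) : Branch R m (t + 1)) ((c i).graft ε).trunc
      = (r, c) := by
  rw [Branch.trunc_graft]
  simp [nodeView]

omit [MeasurableSpace R] in
theorem halfView_cut (r : R) (i : Fin (m + 1)) (c : Fin (m + 1) → Branch R m t)
    (ε : Branch R m (t + 1)) (e : Fin m → Branch R m (t + 1)) :
    halfView (t := t) (((r, i), i.removeNth c) : Branch R m (t + 1)) ((c i).graft ε) e
      = (r, fun k => (c k).graft ((i.insertNth ε e : Fin (m + 1) → Branch R m (t + 1)) k)) := by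
  simp only [halfView]
  congr 1
  ext k : 1
  refine Fin.succAboveCases i ?_ (fun j => ?_) k
  · simp
  · simp [Fin.removeNth]

/-- The decision of the simulated algorithm is rarely different from the likely decision of the
original one. -/
theorem simulate_not_iff_le {F : Fin (m + 1) → Set (View R m (t + 1))}
    (hF : ∀ i, MeasurableSet (F i)) {b : ℕ} (hb : 1 ≤ b)
    (hcard : ∀ q, {i | q ∈ F i}.ncard = b) :
    (((branchMeasure ν m (t + 1)).prod (branchMeasure ν m (t + 1))).prod
      (Measure.pi fun _ : Fin (m + 1) => branchMeasure ν m (t + 1)))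
      {x | ¬ (x.1 ∈ grabSet (simulate F x.2) ↔ 2⁻¹ ≤ grabProb ν F x.1)} ≤
    ENNReal.ofReal (1 + 21 * √b) * mismatch ν F := by
  set ρ := branchMeasure ν m (t + 1) with hρ
  set π := Measure.pi fun _ : Fin (m + 1) => ρ with hπ
  set πm := Measure.pi fun _ : Fin m => ρ with hπm
  set κ := Measure.pi fun _ : Fin (m + 1) => branchMeasure ν m t with hκ
  set K := ENNReal.ofReal (1 + 21 * √b)
  set Fq : (R × (Fin (m + 1) → Branch R m t)) → Fin (m + 1) →
    Set (Fin (m + 1) → Branch R m (t + 1)) := fun q i => {e | q ∈ simulate F e i} with hFq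
  have hFqm : ∀ q i, MeasurableSet (Fq q i) := fun q i =>
    measurable_prodMk_left (x := q) (measurableSet_simulate_uncurry hF i)
  have hm1 : MeasurableSet {x : (Branch R m (t + 1) × Branch R m (t + 1)) ×
      (Fin (m + 1) → Branch R m (t + 1)) |
      ¬ (x.1 ∈ grabSet (simulate F x.2) ↔ 2⁻¹ ≤ grabProb ν F x.1)} :=
    measurableSet_not_iff (measurableSet_grabSet_simulate hF)
      (measurableSet_le measurable_const ((measurable_grabProb ν hF).comp measurable_fst))
  -- Seen through this cut, an edge is a `t`-view `(r, c)`, a uniform port `i` and one more level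
  -- `ε` behind that port. The simulated decision then depends on the view, `i` and `e`, the likely
  -- decision on the view, `i` and `ε`.
  have hcut := measurePreserving_cut (m := m) ν t
  have hprob : ∀ (r : R) (i : Fin (m + 1)) (c : Fin (m + 1) → Branch R m t)
      (ε : Branch R m (t + 1)),
      {e : Fin m → Branch R m (t + 1) | halfView (t := t)
        (((r, i), i.removeNth c) : Branch R m (t + 1)) ((c i).graft ε) e ∈ F i}
        = {e | (i.insertNth ε e : Fin (m + 1) → Branch R m (t + 1)) ∈ Fq (r, c) i} :=
    fun r i c ε => by
      ext e
      simp only [Set.mem_ofPred_eq, halfView_cut]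
      rfl
  have hA := hcut.prod (MeasurePreserving.id π)
  set H1 : (R × Fin (m + 1)) × (Fin (m + 1) → Branch R m t) → ENNReal := fun y =>
    (π.prod ρ) {p | ¬ (p.1 ∈ Fq (y.1.1, y.2) y.1.2 ↔
      p.2 ∈ likely ρ (Fq (y.1.1, y.2) y.1.2) y.1.2)} with hH1
  set H2 : (R × Fin (m + 1)) × (Fin (m + 1) → Branch R m t) → ENNReal := fun y =>
    ∫⁻ ε, min (πm {e | (y.1.2.insertNth ε e : Fin (m + 1) → Branch R m (t + 1)) ∈
        Fq (y.1.1, y.2) y.1.2})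
      (πm {e | (y.1.2.insertNth ε e : Fin (m + 1) → Branch R m (t + 1)) ∈
        Fq (y.1.1, y.2) y.1.2}ᶜ) ∂ρ with hH2
  have hm2 := MeasurableEquiv.prodAssoc.symm.measurable (hA.measurable hm1)
  have swapm : MeasurePreserving (Prod.swap : (Fin (m + 1) → Branch R m (t + 1)) ×
      Branch R m (t + 1) → _) (π.prod ρ) (ρ.prod π) := Measure.measurePreserving_swap
  have eH1 : ∀ y, H1 y = (ρ.prod π) (Prod.mk y ⁻¹' (MeasurableEquiv.prodAssoc.symm ⁻¹'
      (Prod.map (fun p : ((R × Fin (m + 1)) × (Fin (m + 1) → Branch R m t)) × Branch R m (t + 1) =>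
        (((p.1.1, p.1.1.2.removeNth p.1.2),
          (p.1.2 p.1.1.2).graft p.2) : Branch R m (t + 1) × Branch R m (t + 1))) id ⁻¹'
        {x : (Branch R m (t + 1) × Branch R m (t + 1)) ×
          (Fin (m + 1) → Branch R m (t + 1)) |
          ¬ (x.1 ∈ grabSet (simulate F x.2) ↔ 2⁻¹ ≤ grabProb ν F x.1)}))) := fun y => by
    rw [← swapm.measure_preimage (measurable_prodMk_left hm2).nullMeasurableSet]
    refine congrArg (fun s => (π.prod ρ) s) ?_
    ext ⟨e, ε⟩
    obtain ⟨⟨r, i⟩, c⟩ := y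
    refine not_congr (iff_congr ?_ ?_)
    · show _ ↔ nodeView (t := t) (((r, i), i.removeNth c) : Branch R m (t + 1))
        ((c i).graft ε).trunc ∈ simulate F e i
      rw [nodeView_cut]
      rfl
    · show _ ↔ 2⁻¹ ≤ πm {e : Fin m → Branch R m (t + 1) | halfView (t := t)
        (((r, i), i.removeNth c) : Branch R m (t + 1)) ((c i).graft ε) e ∈ F i}
      rw [hprob]
      rfl
  have hH1m : Measurable H1 := by
    have := measurable_measure_prodMk_left (ν := ρ.prod π) hm2
    convert this using 1
    funext y
    exact eH1 y
  have hmin : Measurable fun p => min (grabProb ν F p) (grabProbCompl ν F p) :=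
    (measurable_grabProb ν hF).min (measurable_grabProbCompl ν hF)
  have eH2 : ∀ y, H2 y = ∫⁻ ε, (fun p => min (grabProb ν F p) (grabProbCompl ν F p))
      (((y.1, y.1.2.removeNth y.2), (y.2 y.1.2).graft ε) :
        Branch R m (t + 1) × Branch R m (t + 1)) ∂ρ := fun y => by
    obtain ⟨⟨r, i⟩, c⟩ := y
    refine lintegral_congr fun ε => ?_
    show _ = min (πm {e : Fin m → Branch R m (t + 1) | halfView (t := t)
        (((r, i), i.removeNth c) : Branch R m (t + 1)) ((c i).graft ε) e ∈ F i})
        (πm {e : Fin m → Branch R m (t + 1) | halfView (t := t)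
        (((r, i), i.removeNth c) : Branch R m (t + 1)) ((c i).graft ε) e ∈ F i}ᶜ)
    rw [hprob]
  have hH2m : Measurable H2 := by
    have := Measurable.lintegral_prod_right' (ν := ρ) (hmin.comp hcut.measurable)
    convert this using 1
    funext y
    exact eH2 y
  -- The resampling inequality at a fixed view. It compares only the sums over all ports, not the
  -- single ports, which is why the port must be uniform.
  have step : ∀ r c, ∑ i, H1 ((r, i), c) ≤ K * ∑ i, H2 ((r, i), c) := fun r c => by
    refine (sum_resampled_pi_le ρ hb (F := fun i => Fq (r, c) i) (fun i => hFqm _ i)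
      (fun e => hcard _) (Y := fun i => likely ρ (Fq (r, c) i) i)
      fun i => measurableSet_likely ρ (hFqm _ i) i).trans ?_
    gcongr with i
    exact not_iff_likely_le ρ (hFqm _ i) i
  calc _ = ∫⁻ y, H1 y ∂((ν.prod (portMeasure m)).prod κ) := by
        rw [← hA.measure_preimage hm1.nullMeasurableSet,
          ← ((measurePreserving_prodAssoc ((ν.prod (portMeasure m)).prod κ) ρ π).symm).measure_preimage
            (hA.measurable hm1).nullMeasurableSet, Measure.prod_apply hm2]
        exact lintegral_congr fun y => (eH1 y).symm
    _ = ∫⁻ c, ∫⁻ r, (m + 1 : ENNReal)⁻¹ * ∑ i, H1 ((r, i), c) ∂ν ∂κ := lintegral_port ν κ hH1m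
    _ ≤ ∫⁻ c, ∫⁻ r, (m + 1 : ENNReal)⁻¹ * ∑ i, K * H2 ((r, i), c) ∂ν ∂κ := by
        refine lintegral_mono fun c => lintegral_mono fun r => ?_
        dsimp only
        rw [← Finset.mul_sum]
        gcongr
        exact step r c
    _ = ∫⁻ y, K * H2 y ∂((ν.prod (portMeasure m)).prod κ) :=
        (lintegral_port ν κ (hH2m.const_mul K)).symm
    _ = K * ∫⁻ p, min (grabProb ν F p) (grabProbCompl ν F p) ∂(ρ.prod ρ) := by
        rw [lintegral_const_mul _ hH2m, ← hcut.lintegral_comp hmin]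
        refine congrArg (K * ·) ?_
        exact ((lintegral_prod _ (hmin.comp hcut.measurable).aemeasurable).trans
          (lintegral_congr fun y => (eH2 y).symm)).symm
    _ ≤ K * mismatch ν F := by
        rw [mismatch_eq ν hF]
        gcongr with p
        exact xor_bound (grabProb_add_compl ν hF p.swap)

/-- Where the likely decisions of the two ends differ, the actual ones, being conditionally
independent, differ with probability at least `1 / 2`. -/
theorem likely_not_iff_le {F : Fin (m + 1) → Set (View R m (t + 1))}
    (hF : ∀ i, MeasurableSet (F i)) :
    ((branchMeasure ν m (t + 1)).prod (branchMeasure ν m (t + 1)))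
      {p | ¬ (2⁻¹ ≤ grabProb ν F p ↔ 2⁻¹ ≤ grabProb ν F p.swap)} ≤ 2 * mismatch ν F := by
  have hm : MeasurableSet {p | ¬ (2⁻¹ ≤ grabProb ν F p ↔ 2⁻¹ ≤ grabProb ν F p.swap)} :=
    measurableSet_not_iff (measurableSet_le measurable_const (measurable_grabProb ν hF))
      (measurableSet_le measurable_const ((measurable_grabProb ν hF).comp measurable_swap))
  rw [mismatch_eq ν hF, ← lintegral_indicator_one hm, ← lintegral_const_mul]
  · refine lintegral_mono fun p => ?_
    refine Set.indicator_apply_le' (fun hp => ?_) fun _ => zero_le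
    show (1 : ENNReal) ≤ _
    have h1 := grabProb_add_compl ν hF p
    have h2 := grabProb_add_compl ν hF p.swap
    rcases le_or_gt 2⁻¹ (grabProb ν F p) with h | h
    · have h' : grabProb ν F p.swap < 2⁻¹ := not_le.1 fun h' => hp (iff_of_true h h')
      exact half_le_xor h1 h2 h h'.le
    · have h' : 2⁻¹ ≤ grabProb ν F p.swap := by
        by_contra h'
        exact hp (iff_of_false (not_le.2 h) h')
      refine (half_le_xor h2 h1 h' h.le).trans (le_of_eq ?_)
      ring
  · exact ((measurable_grabProb ν hF).mul
      ((measurable_grabProbCompl ν hF).comp measurable_swap)).add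
      ((measurable_grabProbCompl ν hF).mul ((measurable_grabProb ν hF).comp measurable_swap))

/-- One round can be saved at the price of a factor `46 √b` in the number of mismatches. -/
theorem exists_round_elimination {F : Fin (m + 1) → Set (View R m (t + 1))}
    (hF : ∀ i, MeasurableSet (F i)) {b : ℕ} (hb : 1 ≤ b)
    (hcard : ∀ q, {i | q ∈ F i}.ncard = b) :
    ∃ F' : Fin (m + 1) → Set (View R m t), (∀ i, MeasurableSet (F' i)) ∧
      (∀ q, {i | q ∈ F' i}.ncard = b) ∧
      mismatch ν F' ≤ ENNReal.ofReal (46 * √b) * mismatch ν F := by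
  set ρ := branchMeasure ν m (t + 1) with hρ
  set π := Measure.pi fun _ : Fin (m + 1) => ρ with hπ
  have hg := measurableSet_grabSet_simulate hF
  have hsw : Measurable fun x : (Branch R m (t + 1) × Branch R m (t + 1)) ×
      (Fin (m + 1) → Branch R m (t + 1)) => (x.1.swap, x.2) :=
    (measurable_swap.comp measurable_fst).prodMk measurable_snd
  have hm : MeasurableSet {x : (Branch R m (t + 1) × Branch R m (t + 1)) ×
      (Fin (m + 1) → Branch R m (t + 1)) |
      ¬ (x.1 ∈ grabSet (simulate F x.2) ↔ x.1.swap ∈ grabSet (simulate F x.2))} :=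
    measurableSet_not_iff hg (hsw hg)
  have hmeas : Measurable fun e => mismatch ν (simulate F e) := measurable_measure_prodMk_right hm
  -- Some invented last level is at least as good as the average one. The same `e` is used at all
  -- nodes, so it becomes part of the rule.
  obtain ⟨e, he⟩ := exists_le_lintegral (μ := π) hmeas.aemeasurable
  refine ⟨simulate F e, measurableSet_simulate hF e, fun q => hcard _, he.trans ?_⟩
  have hint : ∫⁻ e, mismatch ν (simulate F e) ∂π = ((ρ.prod ρ).prod π)
      {x | ¬ (x.1 ∈ grabSet (simulate F x.2) ↔ x.1.swap ∈ grabSet (simulate F x.2))} :=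
    (Measure.prod_apply_symm hm).symm
  rw [hint]
  have hA := simulate_not_iff_le ν hF hb hcard
  have hL := likely_not_iff_le ν hF
  rw [← hρ] at hA hL
  rw [← hπ] at hA
  set A : Set ((Branch R m (t + 1) × Branch R m (t + 1)) × (Fin (m + 1) → Branch R m (t + 1))) :=
    {x | ¬ (x.1 ∈ grabSet (simulate F x.2) ↔ 2⁻¹ ≤ grabProb ν F x.1)} with hAdef
  set L : Set (Branch R m (t + 1) × Branch R m (t + 1)) :=
    {p | ¬ (2⁻¹ ≤ grabProb ν F p ↔ 2⁻¹ ≤ grabProb ν F p.swap)} with hLdef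
  have hAm : MeasurableSet A := measurableSet_not_iff hg
    (measurableSet_le measurable_const ((measurable_grabProb ν hF).comp measurable_fst))
  have hswm : MeasurePreserving (fun x : (Branch R m (t + 1) × Branch R m (t + 1)) ×
      (Fin (m + 1) → Branch R m (t + 1)) => (x.1.swap, x.2)) ((ρ.prod ρ).prod π)
      ((ρ.prod ρ).prod π) :=
    (Measure.measurePreserving_swap (μ := ρ) (ν := ρ)).prod (MeasurePreserving.id π)
  have hLm : MeasurableSet L :=
    measurableSet_not_iff (measurableSet_le measurable_const (measurable_grabProb ν hF))
      (measurableSet_le measurable_const ((measurable_grabProb ν hF).comp measurable_swap))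
  -- If both simulated decisions are the likely ones and the likely ones agree, there is no
  -- mismatch.
  have hsub : {x : (Branch R m (t + 1) × Branch R m (t + 1)) ×
      (Fin (m + 1) → Branch R m (t + 1)) |
      ¬ (x.1 ∈ grabSet (simulate F x.2) ↔ x.1.swap ∈ grabSet (simulate F x.2))} ⊆
      (A ∪ Prod.fst ⁻¹' L) ∪ (fun x => (x.1.swap, x.2)) ⁻¹' A := by
    intro x hx
    simp only [hAdef, hLdef, Set.mem_union, Set.mem_preimage, Set.mem_ofPred_eq] at hx ⊢
    tauto
  have hb1 : (1 : ℝ) ≤ √b := Real.one_le_sqrt.2 (by exact_mod_cast hb)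
  calc _ ≤ ((ρ.prod ρ).prod π) A + ((ρ.prod ρ).prod π) (Prod.fst ⁻¹' L)
        + ((ρ.prod ρ).prod π) ((fun x => (x.1.swap, x.2)) ⁻¹' A) :=
        (measure_mono hsub).trans ((measure_union_le _ _).trans
          (add_le_add_left (measure_union_le _ _) _))
    _ = ((ρ.prod ρ).prod π) A + (ρ.prod ρ) L + ((ρ.prod ρ).prod π) A := by
        rw [hswm.measure_preimage hAm.nullMeasurableSet,
          (measurePreserving_fst (μ := ρ.prod ρ) (ν := π)).measure_preimage
            hLm.nullMeasurableSet]
    _ ≤ ENNReal.ofReal (1 + 21 * √b) * mismatch ν F + 2 * mismatch ν F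
        + ENNReal.ofReal (1 + 21 * √b) * mismatch ν F := by gcongr
    _ = ENNReal.ofReal ((1 + 21 * √b) + 2 + (1 + 21 * √b)) * mismatch ν F := by
        have hx : 0 ≤ 1 + 21 * √(b : ℝ) := by positivity
        generalize 1 + 21 * √(b : ℝ) = x at hx
        rw [ENNReal.ofReal_add (by positivity) hx, ENNReal.ofReal_add hx zero_le_two,
          ENNReal.ofReal_ofNat]
        ring
    -- The constant is `2 * (1 + 21 * √b) + 2 = 4 + 42 * √b`, at most `46 * √b` because `√b ≥ 1`.
    _ ≤ ENNReal.ofReal (46 * √b) * mismatch ν F := by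
        gcongr
        linarith

/-- Without communication a node chooses its ports independently of the other end, and a uniform
port is among them with probability `s = b / (m + 1) ≤ 1 / 2`. The mismatch is `2 * s * (1 - s) ≥
s`. -/
theorem le_mismatch_zero {F : Fin (m + 1) → Set (View R m 0)}
    (hF : ∀ i, MeasurableSet (F i)) {b : ℕ} (hbm : 2 * b ≤ m + 1)
    (hcard : ∀ q, {i | q ∈ F i}.ncard = b) :
    (m + 1 : ENNReal)⁻¹ * b ≤ mismatch ν F := by
  classical
  set ρ := branchMeasure ν m 1 with hρ
  let c0 : Fin (m + 1) → Branch R m 0 := fun _ => ()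
  set S : Set (Branch R m 1) := {γ | (γ.1.1, c0) ∈ F γ.1.2} with hS
  have hSm : MeasurableSet S :=
    measurableSet_indexed (i := fun γ : Branch.Unfolded R m 0 => γ.1.2)
      (measurable_snd.comp measurable_fst) fun k =>
      ((measurable_fst.comp measurable_fst).prodMk measurable_const :
        Measurable fun γ : Branch.Unfolded R m 0 => (γ.1.1, c0)) (hF k)
  have hgrab : ∀ p : Branch R m 1 × Branch R m 1, p ∈ grabSet F ↔ p.1 ∈ S := fun p => Iff.rfl
  have hmis : mismatch ν F = ρ S * ρ Sᶜ + ρ Sᶜ * ρ S := by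
    rw [← prod_not_iff ρ ρ hSm hSm]; rfl
  have hρS : ρ S = (m + 1 : ENNReal)⁻¹ * b := by
    rw [← lintegral_indicator_one hSm]
    refine (lintegral_port ν (Measure.pi fun _ : Fin m => branchMeasure ν m 0)
      (H := S.indicator 1) (measurable_one.indicator hSm)).trans ?_
    have : ∀ (c : Fin m → Branch R m 0) (r : R),
        ∑ i, S.indicator (1 : Branch R m 1 → ENNReal) (((r, i), c) : Branch R m 1) = b :=
      fun c r => by
        have h1 : ∀ i, S.indicator (1 : Branch R m 1 → ENNReal) (((r, i), c) : Branch R m 1)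
            = if (r, c0) ∈ F i then 1 else 0 := fun i => by
          by_cases h : (r, c0) ∈ F i
          · rw [if_pos h]
            exact Set.indicator_of_mem (show (((r, i), c) : Branch R m 1) ∈ S from h) _
          · rw [if_neg h]
            exact Set.indicator_of_notMem (show (((r, i), c) : Branch R m 1) ∉ S from h) _
        rw [Finset.sum_congr rfl fun i _ => h1 i, ← hcard (r, c0), Set.ncard_eq_toFinset_card',
          Finset.sum_boole]
        simp
    simp_rw [this]
    simp
  have hle : ρ S ≤ 2⁻¹ := by
    rw [hρS, ENNReal.inv_mul_le_iff (by simp) (by finiteness), ← div_eq_mul_inv,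
      ENNReal.le_div_iff_mul_le (by simp) (by simp)]
    exact_mod_cast (by linarith : b * 2 ≤ m + 1)
  have hc : 2⁻¹ ≤ ρ Sᶜ := by
    rw [prob_compl_eq_one_sub hSm, ← ENNReal.one_sub_inv_two]
    exact tsub_le_tsub_left hle 1
  rw [← hρS, hmis]
  calc ρ S = ρ S * 2⁻¹ + 2⁻¹ * ρ S := by
        rw [mul_comm (2⁻¹ : ENNReal), ← mul_add, ENNReal.inv_two_add_inv_two, mul_one]
    _ ≤ _ := by gcongr

/-- Lower bound for the mismatches of a `t`-round algorithm on the tree. -/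
theorem le_mismatch : ∀ {t : ℕ} {F : Fin (m + 1) → Set (View R m t)},
    (∀ i, MeasurableSet (F i)) → ∀ {b : ℕ}, 1 ≤ b → 2 * b ≤ m + 1 →
    (∀ q, {i | q ∈ F i}.ncard = b) →
    (m + 1 : ENNReal)⁻¹ * b ≤ ENNReal.ofReal (46 * √b) ^ t * mismatch ν F
  | 0, F, hF, b, _, hbm, hcard => by simpa using le_mismatch_zero ν hF hbm hcard
  | t + 1, F, hF, b, hb, hbm, hcard => by
    obtain ⟨F', hF', hcard', hle⟩ := exists_round_elimination ν hF hb hcard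
    refine (le_mismatch hF' hb hbm hcard').trans ?_
    rw [pow_succ, mul_assoc]
    gcongr

end LocalModel

namespace LocalModel
open ProbabilityTheory

variable {V : Type} {G : SimpleGraph V} {R : Type} {m : ℕ}

/-! ### Views in a graph -/

/-- The port of a half-edge. -/
def portOf (π : PortNumbering G (m + 1)) (d : G.Dart) : Fin (m + 1) :=
  (π d.fst).symm ⟨d.snd, d.adj⟩

/-- The half-edge from the neighbor of `v` at port `i` to `v`. -/
def backDart (π : PortNumbering G (m + 1)) (v : V) (i : Fin (m + 1)) : G.Dart :=
  ⟨((π v i : V), v), (π v i).2.symm⟩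

/-- The branch of depth `t` that contains the first node of a half-edge, seen from the second. -/
def graphBranch (x : V → R) (π : PortNumbering G (m + 1)) : ∀ t, G.Dart → Branch R m t
  | 0, _ => ()
  | t + 1, d => ((x d.fst, portOf π d),
      fun j => graphBranch x π t (backDart π d.fst ((portOf π d).succAbove j)))

/-- The view of a node after `t` rounds. -/
def graphView (x : V → R) (π : PortNumbering G (m + 1)) (t : ℕ) (v : V) : View R m t :=
  (x v, fun i => graphBranch x π t (backDart π v i))

theorem trunc_graphBranch (x : V → R) (π : PortNumbering G (m + 1)) : ∀ t (d : G.Dart),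
    (graphBranch x π (t + 1) d).trunc = graphBranch x π t d
  | 0, _ => rfl
  | t + 1, d => by
    show ((x d.fst, portOf π d), fun j => (graphBranch x π (t + 1) _).trunc) = _
    simp only [trunc_graphBranch x π t]
    rfl

theorem backDart_portOf (π : PortNumbering G (m + 1)) (d : G.Dart) :
    backDart π d.fst (portOf π d) = d.symm := by
  apply SimpleGraph.Dart.ext
  simp [backDart, portOf]
  rfl

theorem portOf_symm_backDart (π : PortNumbering G (m + 1)) (v : V) (i : Fin (m + 1)) :
    portOf π (backDart π v i).symm = i := by
  exact (π v).symm_apply_apply i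

theorem nodeView_graphBranch (x : V → R) (π : PortNumbering G (m + 1)) (t : ℕ) (d : G.Dart) :
    nodeView (graphBranch x π (t + 1) d) (graphBranch x π t d.symm) = graphView x π t d.fst := by
  show (x d.fst, _) = (x d.fst, _)
  congr 1
  ext k : 1
  refine Fin.succAboveCases (portOf π d) ?_ (fun j => ?_) k
  · show (portOf π d).insertNth (α := fun _ => Branch R m t) _ _ (portOf π d) = _
    rw [Fin.insertNth_apply_same, backDart_portOf]
  · show (portOf π d).insertNth (α := fun _ => Branch R m t) _ _ _ = _
    rw [Fin.insertNth_apply_succAbove]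
    rfl

/-- The branch behind a neighbor of the root of a view that contains the root. -/
def View.backBranch {t : ℕ} (q : View R m (t + 1)) (i : Fin (m + 1)) : Branch R m t :=
  -- The branch is built two levels too deep and cut twice, which avoids a case distinction on `t`.
  Branch.trunc (Branch.trunc (((q.1, i), i.removeNth q.2) : Branch R m (t + 1 + 1)))

theorem backBranch_graphView (x : V → R) (π : PortNumbering G (m + 1)) (t : ℕ) (v : V)
    (i : Fin (m + 1)) :
    (graphView x π (t + 1) v).backBranch i = graphBranch x π t (backDart π v i).symm := by
  rw [← trunc_graphBranch, ← trunc_graphBranch]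
  show _ = Branch.trunc (Branch.trunc (((x v, portOf π (backDart π v i).symm), fun j =>
    graphBranch x π (t + 1) (backDart π v ((portOf π (backDart π v i).symm).succAbove j))) :
      Branch R m (t + 1 + 1)))
  rw [portOf_symm_backDart]
  rfl

/-- The state of a node as a function of its view. -/
def evalState (A : LocalAlgorithm (m + 1)) (s : BitStream) : ∀ t, View BitStream m t → A.State
  | 0, q => A.init (q.1, s)
  | t + 1, q => A.recv (evalState A s t (q.1, fun k => (q.2 k).trunc), fun i =>
      A.send (evalState A s t (nodeView (q.2 i) (q.backBranch i))) (q.2 i).1.2)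

theorem evalState_graphView (A : LocalAlgorithm (m + 1)) (s : BitStream) (x : V → BitStream)
    (π : PortNumbering G (m + 1)) : ∀ t v,
    evalState A s t (graphView x π t v) = A.stateAt π (x, s) t v
  | 0, _ => rfl
  | t + 1, v => by
    have ih := evalState_graphView A s x π t
    have h1 : ((graphView x π (t + 1) v).1, fun k => ((graphView x π (t + 1) v).2 k).trunc)
        = graphView x π t v := by
      simp only [graphView, trunc_graphBranch]
    have h2 : ∀ i, nodeView ((graphView x π (t + 1) v).2 i)
        ((graphView x π (t + 1) v).backBranch i) = graphView x π t (π v i) := fun i => by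
      rw [backBranch_graphView]
      exact nodeView_graphBranch x π t (backDart π v i)
    simp only [evalState, h1, h2, ih]
    rfl

theorem measurable_nodeView_apply [MeasurableSpace R] {t : ℕ} {X : Type*} [MeasurableSpace X]
    {f : X → Branch R m (t + 1)} {g : X → Branch R m t} (hf : Measurable f) (hg : Measurable g) :
    Measurable fun x => nodeView (f x) (g x) :=
  measurable_nodeView.comp (hf.prodMk hg)

theorem measurable_port [MeasurableSpace R] {t : ℕ} :
    Measurable fun γ : Branch R m (t + 1) => γ.1.2 :=
  (measurable_snd.comp measurable_fst : Measurable fun γ : Branch.Unfolded R m t => γ.1.2)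

theorem measurable_backBranch [MeasurableSpace R] {t : ℕ} (i : Fin (m + 1)) :
    Measurable fun q : View R m (t + 1) => q.backBranch i := by
  have h : Measurable fun q : View R m (t + 1) =>
      (((q.1, i), i.removeNth q.2) : Branch.Unfolded R m (t + 1)) :=
    (measurable_fst.prodMk measurable_const).prodMk (measurable_pi_lambda _ fun j =>
      (measurable_pi_apply _).comp measurable_snd)
  exact (Branch.measurable_trunc t).comp ((Branch.measurable_trunc (t + 1)).comp h)

theorem measurable_evalState (A : LocalAlgorithm (m + 1)) (s : BitStream) : ∀ t,
    Measurable (evalState A s t)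
  | 0 => A.measurable_init.comp (measurable_fst.prodMk measurable_const)
  | t + 1 => by
    have ih := measurable_evalState A s t
    have hq : ∀ i, Measurable fun q : View BitStream m (t + 1) => q.2 i := fun i =>
      (measurable_pi_apply i).comp measurable_snd
    refine A.measurable_recv.comp (Measurable.prodMk (ih.comp (measurable_fst.prodMk
      (measurable_pi_lambda _ fun k => (Branch.measurable_trunc t).comp (hq k))))
      (measurable_pi_lambda _ fun i => ?_))
    refine measurable_of_index (f := fun k (q : View BitStream m (t + 1)) =>
      A.send (evalState A s t (nodeView (q.2 i) (q.backBranch i))) k)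
      (measurable_port.comp (hq i)) fun k => ?_
    exact (measurable_pi_apply k).comp (A.measurable_send.comp
      (ih.comp (measurable_nodeView_apply (hq i) (measurable_backBranch i))))

theorem measurable_stateAt {Δ : ℕ} (A : LocalAlgorithm Δ) (π : PortNumbering G Δ) : ∀ t v,
    Measurable fun ω => A.stateAt π ω t v
  | 0, v => A.measurable_init.comp
      (((measurable_pi_apply v).comp measurable_fst).prodMk measurable_snd)
  | t + 1, v => by
    have ih := measurable_stateAt A π t
    exact A.measurable_recv.comp ((ih v).prodMk (measurable_pi_lambda _ fun i =>
      (measurable_pi_apply _).comp (A.measurable_send.comp (ih (π v i)))))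

/-! ### The nodes on which a branch depends -/

/-- The nodes of a branch of depth `t`. -/
def branchNodes (G : SimpleGraph V) : ℕ → G.Dart → Set V
  | 0, _ => ∅
  | t + 1, d => {d.fst} ∪ {z | ∃ (u : V) (h : G.Adj u d.fst), u ≠ d.snd ∧
      z ∈ branchNodes G t ⟨(u, d.fst), h⟩}

theorem portOf_succAbove_ne (π : PortNumbering G (m + 1)) (d : G.Dart) (j : Fin m) :
    (π d.fst ((portOf π d).succAbove j) : V) ≠ d.snd := by
  intro h
  have h1 : π d.fst ((portOf π d).succAbove j) = ⟨d.snd, d.adj⟩ := Subtype.ext h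
  have h2 : (portOf π d).succAbove j = portOf π d :=
    (π d.fst).injective (h1.trans (Equiv.apply_symm_apply _ _).symm)
  exact Fin.succAbove_ne _ _ h2

theorem graphBranch_congr {x x' : V → R} {π π' : PortNumbering G (m + 1)} : ∀ {t} {d : G.Dart},
    (∀ v ∈ branchNodes G t d, x v = x' v ∧ π v = π' v) →
      graphBranch x π t d = graphBranch x' π' t d
  | 0, _, _ => rfl
  | t + 1, d, h => by
    obtain ⟨hx, hπ⟩ := h d.fst (Or.inl rfl)
    have hp : portOf π d = portOf π' d := by rw [portOf, portOf, hπ]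
    have hc : ∀ j : Fin m, graphBranch x π t (backDart π d.fst ((portOf π d).succAbove j))
        = graphBranch x' π' t (backDart π' d.fst ((portOf π' d).succAbove j)) := fun j => by
      have hb : backDart π' d.fst ((portOf π' d).succAbove j)
          = backDart π d.fst ((portOf π d).succAbove j) := by
        apply SimpleGraph.Dart.ext
        simp only [backDart, hp, hπ]
      rw [hb]
      exact graphBranch_congr fun v hv =>
        h v (Or.inr ⟨_, (π d.fst ((portOf π d).succAbove j)).2.symm, portOf_succAbove_ne π d j, hv⟩)
    show ((x d.fst, portOf π d), _) = ((x' d.fst, portOf π' d), _)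
    rw [hx, hp]
    exact congrArg (Prod.mk _) (funext fun j => by have := hc j; rwa [hp] at this)

/-- Two different paths with the same ends contain a cycle no longer than both together. -/
theorem isPath_eq_of_length_lt {a z : V} {p q : G.Walk a z} (hp : p.IsPath) (hq : q.IsPath)
    (h : ((p.length + q.length : ℕ) : ℕ∞) < G.egirth) : p = q := by
  by_contra hne
  obtain ⟨u, -, -, c, hc, hle⟩ := hp.exists_isCycle_length_le_add_of_ne hq hne
  exact absurd ((SimpleGraph.egirth_le_length hc).trans (by exact_mod_cast hle)) (not_le.2 h)

/-- The nodes of a branch are reached by short paths through its root. -/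
theorem exists_isPath_of_mem_branchNodes : ∀ {t : ℕ} {d : G.Dart} {z : V},
    ((t + 1 : ℕ) : ℕ∞) < G.egirth → z ∈ branchNodes G t d →
      ∃ p : G.Walk d.fst z, (SimpleGraph.Walk.cons d.adj.symm p).IsPath ∧ p.length < t
  | 0, _, _, _, hz => hz.elim
  | t + 1, d, z, hg, hz => by
    classical
    rcases hz with hz | ⟨u, h, hu, hz⟩
    · obtain rfl : z = d.fst := hz
      exact ⟨.nil, by simp [SimpleGraph.Walk.cons_isPath_iff, d.adj.ne'], by simp⟩
    · obtain ⟨p, hp, hl⟩ := exists_isPath_of_mem_branchNodes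
        (lt_of_le_of_lt (by norm_cast; omega) hg) hz
      refine ⟨.cons h.symm p, ?_, by simpa using hl⟩
      rw [SimpleGraph.Walk.cons_isPath_iff]
      refine ⟨hp, fun hmem => hu ?_⟩
      have hpath : (SimpleGraph.Walk.cons d.adj (.nil : G.Walk d.snd d.snd)).IsPath := by
        simp [SimpleGraph.Walk.cons_isPath_iff, d.adj.ne]
      have hlen := SimpleGraph.Walk.length_takeUntil_le_length (SimpleGraph.Walk.cons h.symm p) hmem
      -- If the extended path returned to `d.snd`, its initial piece would, by the girth, be the
      -- single edge from `d.fst` to `d.snd`; its second node `u` would then be `d.snd`.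
      have heq := isPath_eq_of_length_lt (hp.takeUntil hmem) hpath
        (lt_of_le_of_lt (by
          norm_cast
          simp only [SimpleGraph.Walk.length_cons, SimpleGraph.Walk.length_nil] at hlen ⊢
          omega) hg)
      have hspec := SimpleGraph.Walk.take_spec (SimpleGraph.Walk.cons h.symm p) hmem
      rw [heq] at hspec
      simpa using (congrArg SimpleGraph.Walk.snd hspec).symm

theorem snd_notMem_branchNodes {t : ℕ} {d : G.Dart} (hg : ((t + 1 : ℕ) : ℕ∞) < G.egirth) :
    d.snd ∉ branchNodes G t d := fun h => by
  obtain ⟨p, hp, -⟩ := exists_isPath_of_mem_branchNodes hg h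
  exact ((SimpleGraph.Walk.cons_isPath_iff _ _).1 hp).2 p.end_mem_support

theorem disjoint_branchNodes_of_ne {t : ℕ} {u u' w : V} {h : G.Adj u w} {h' : G.Adj u' w}
    (hne : u ≠ u') (hg : ((t + 1 : ℕ) : ℕ∞) < G.egirth) (hg2 : ((2 * t : ℕ) : ℕ∞) < G.egirth) :
    Disjoint (branchNodes G t ⟨(u, w), h⟩) (branchNodes G t ⟨(u', w), h'⟩) := by
  rw [Set.disjoint_left]
  intro z hz hz'
  obtain ⟨p, hp, hl⟩ := exists_isPath_of_mem_branchNodes hg hz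
  obtain ⟨p', hp', hl'⟩ := exists_isPath_of_mem_branchNodes hg hz'
  have := isPath_eq_of_length_lt hp hp' (lt_of_le_of_lt (by
    norm_cast
    simp only [SimpleGraph.Walk.length_cons]
    omega) hg2)
  exact hne (by simpa using congrArg SimpleGraph.Walk.snd this)

/-- A common node would be joined to `d.fst` by two short paths, only one of which passes through
`d.snd`. Their total length is below `2 * t`, so here the weak inequality for the girth is enough.
-/
theorem disjoint_branchNodes_symm {t : ℕ} {d : G.Dart} (hg : ((t + 1 : ℕ) : ℕ∞) < G.egirth)
    (hg2 : ((2 * t : ℕ) : ℕ∞) ≤ G.egirth) :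
    Disjoint (branchNodes G t d) (branchNodes G t d.symm) := by
  rw [Set.disjoint_left]
  intro z hz hz'
  obtain ⟨p, hp, hl⟩ := exists_isPath_of_mem_branchNodes hg hz
  obtain ⟨p', hp', hl'⟩ := exists_isPath_of_mem_branchNodes hg hz'
  have hp1 := (SimpleGraph.Walk.cons_isPath_iff _ _).1 hp
  have hlt : p.length + (SimpleGraph.Walk.cons d.symm.adj.symm p').length < 2 * t := by
    show p.length + (p'.length + 1) < 2 * t
    omega
  have := isPath_eq_of_length_lt hp1.1 hp' (lt_of_lt_of_le (by exact_mod_cast hlt) hg2)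
  apply hp1.2
  rw [this]
  exact List.mem_cons_of_mem _ p'.start_mem_support

end LocalModel

namespace LocalModel
open ProbabilityTheory

/-! ### Independence of functions of disjoint sets of coordinates -/

/-- The irrelevant coordinates are filled with an arbitrary constant. -/
theorem DependsOn.exists_measurable {V Ω B : Type*} [MeasurableSpace Ω] [MeasurableSpace B]
    [Nonempty Ω] {f : (V → Ω) → B} (hf : Measurable f) {S : Finset V}
    (hS : DependsOn f (S : Set V)) :
    ∃ φ : (S → Ω) → B, Measurable φ ∧ f = fun y => φ fun v => y v := by
  classical
  obtain ⟨ω⟩ := ‹Nonempty Ω›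
  refine ⟨fun z => f fun v => if h : v ∈ S then z ⟨v, h⟩ else ω, hf.comp ?_, ?_⟩
  · refine measurable_pi_lambda _ fun v => ?_
    by_cases h : v ∈ S
    · simpa [h] using measurable_pi_apply _
    · simp [h]
  · funext y
    exact hS fun v hv => by simp [Finset.mem_coe.1 hv]

theorem indepFun_of_dependsOn {V Ω B C : Type*} [Fintype V] [MeasurableSpace Ω] [MeasurableSpace B]
    [MeasurableSpace C] (μ : Measure Ω) [IsProbabilityMeasure μ] {f : (V → Ω) → B}
    {g : (V → Ω) → C} (hf : Measurable f) (hg : Measurable g) {S T : Set V} (hS : DependsOn f S)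
    (hT : DependsOn g T) (hST : Disjoint S T) : IndepFun f g (Measure.pi fun _ : V => μ) := by
  classical
  have : Nonempty Ω := nonempty_of_isProbabilityMeasure μ
  have hS' : DependsOn f (S.toFinset : Set V) := by simpa using hS
  have hT' : DependsOn g (T.toFinset : Set V) := by simpa using hT
  obtain ⟨φ, hφ, rfl⟩ := DependsOn.exists_measurable hf hS'
  obtain ⟨ψ, hψ, rfl⟩ := DependsOn.exists_measurable hg hT'
  have h : iIndepFun (fun (v : V) (y : V → Ω) => y v) (Measure.pi fun _ : V => μ) :=
    iIndepFun_pi (X := fun _ ω => ω) fun _ => aemeasurable_id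
  exact (h.indepFun_finset S.toFinset T.toFinset (Set.disjoint_toFinset.2 hST)
    fun v => measurable_pi_apply v).comp hφ hψ

theorem iIndepFun_of_dependsOn {V Ω ι : Type*} {B : ι → Type*} [Fintype V] [MeasurableSpace Ω]
    [∀ i, MeasurableSpace (B i)] (μ : Measure Ω) [IsProbabilityMeasure μ]
    {f : ∀ i, (V → Ω) → B i} (hf : ∀ i, Measurable (f i)) {S : ι → Set V}
    (hS : ∀ i, DependsOn (f i) (S i)) (hdis : Pairwise (Function.onFun Disjoint S)) :
    iIndepFun f (Measure.pi fun _ : V => μ) := by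
  classical
  rw [iIndepFun_iff_measure_inter_preimage_eq_mul]
  intro s sets hsets
  induction s using Finset.induction_on with
  | empty => simp
  | insert a s ha ih =>
    have hI : IndepFun (f a) (fun y (i : s) => f i y) (Measure.pi fun _ : V => μ) := by
      refine indepFun_of_dependsOn μ (hf a) (measurable_pi_lambda _ fun i => hf i) (hS a)
        (T := ⋃ i ∈ s, S i) (fun y y' h => funext fun i => hS i fun v hv =>
          h v (Set.mem_biUnion i.2 hv)) ?_
      rw [Set.disjoint_iUnion₂_right]
      intro i hi
      exact hdis fun h => ha (h ▸ hi)
    have hpre : (⋂ i ∈ s, f i ⁻¹' sets i)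
        = (fun y (i : s) => f i y) ⁻¹' (Set.univ.pi fun i : s => sets i) := by
      ext y; simp
    rw [Finset.set_biInter_insert, Finset.prod_insert ha,
      ← ih fun i hi => hsets i (Finset.mem_insert_of_mem hi), hpre]
    exact hI.measure_inter_preimage_eq_mul _ _ (hsets a (Finset.mem_insert_self a s))
      (MeasurableSet.univ_pi fun i => hsets i (Finset.mem_insert_of_mem i.2))

theorem pi_map_precomp {ι κ E : Type*} [Fintype ι] [Fintype κ] [MeasurableSpace E] (ρ : Measure E)
    [IsProbabilityMeasure ρ] {k : κ → ι} (hk : Function.Injective k) :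
    (Measure.pi fun _ : ι => ρ).map (fun y j => y (k j)) = Measure.pi fun _ : κ => ρ := by
  have h : iIndepFun (fun (i : ι) (y : ι → E) => y i) (Measure.pi fun _ : ι => ρ) :=
    iIndepFun_pi (X := fun _ ω => ω) fun _ => aemeasurable_id
  rw [(iIndepFun_iff_map_fun_eq_pi_map fun j => (measurable_pi_apply (k j)).aemeasurable).1
    (h.precomp hk)]
  congr 1
  funext j
  exact (measurePreserving_eval (fun _ : ι => ρ) (k j)).map_eq

/-! ### Random port numberings -/

instance (n : ℕ) : MeasurableSpace (Equiv.Perm (Fin n)) := ⊤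

instance (n : ℕ) : DiscreteMeasurableSpace (Equiv.Perm (Fin n)) := ⟨fun _ => trivial⟩

/-- The uniform distribution on the permutations. -/
noncomputable def permMeasure (n : ℕ) : Measure (Equiv.Perm (Fin n)) :=
  (PMF.uniformOfFintype (Equiv.Perm (Fin n))).toMeasure

instance (n : ℕ) : IsProbabilityMeasure (permMeasure n) := by
  unfold permMeasure; infer_instance

theorem permMeasure_apply {n : ℕ} (s : Finset (Equiv.Perm (Fin n))) :
    permMeasure n s = s.card / Fintype.card (Equiv.Perm (Fin n)) := by
  rw [permMeasure, PMF.toMeasure_uniformOfFintype_apply _ (Set.toFinite _).measurableSet]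
  simp

theorem measurePreserving_perm_symm_apply {m : ℕ} (k : Fin (m + 1)) :
    MeasurePreserving (fun σ : Equiv.Perm (Fin (m + 1)) => σ.symm k) (permMeasure (m + 1))
      (portMeasure m) := by
  classical
  have hmeas : Measurable fun σ : Equiv.Perm (Fin (m + 1)) => σ.symm k := measurable_of_finite _
  refine ⟨hmeas, ?_⟩
  set κ := (permMeasure (m + 1)).map fun σ => σ.symm k with hκ
  have : IsProbabilityMeasure κ := Measure.isProbabilityMeasure_map hmeas.aemeasurable
  have hfin : ∀ i, κ {i} = (Finset.univ.filter fun σ : Equiv.Perm (Fin (m + 1)) =>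
      σ.symm k = i).card / Fintype.card (Equiv.Perm (Fin (m + 1))) := fun i => by
    rw [hκ, Measure.map_apply hmeas (measurableSet_singleton i), ← permMeasure_apply]
    congr 1
    ext σ; simp
  have hconst : ∀ i, κ {i} = κ {0} := fun i => by
    rw [hfin, hfin]
    congr 2
    -- Exchanging the ports `0` and `i` is a bijection between the permutations sending `i` to `k`
    -- and those sending `0` to `k`.
    refine Finset.card_bij' (fun σ _ => (Equiv.swap 0 i).trans σ)
      (fun σ _ => (Equiv.swap 0 i).trans σ) ?_ ?_ ?_ ?_
    · intro σ hσ
      simp only [Finset.mem_filter, Finset.mem_univ, true_and] at hσ ⊢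
      simp [hσ]
    · intro σ hσ
      simp only [Finset.mem_filter, Finset.mem_univ, true_and] at hσ ⊢
      simp [hσ]
    · intro σ _; ext x; simp
    · intro σ _; ext x; simp
  have hsum : (m + 1 : ENNReal) * κ {0} = 1 := by
    have h1 : ∑ i, κ {i} = 1 := by
      rw [sum_measure_singleton]; simp
    simp_rw [hconst] at h1
    simpa using h1
  refine Measure.ext_of_singleton fun i => ?_
  rw [hconst, portMeasure, PMF.toMeasure_apply_singleton _ _ (measurableSet_singleton _)]
  rw [ENNReal.eq_inv_of_mul_eq_one_left (a := κ {0}) (b := m + 1) (by rw [mul_comm]; exact hsum)]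
  simp

variable {V : Type} {G : SimpleGraph V} {R : Type} {m : ℕ}

/-- The port numbering obtained from a fixed one by permuting the ports. -/
def permutedPorts (τ : PortNumbering G (m + 1)) (y : V → R × Equiv.Perm (Fin (m + 1))) :
    PortNumbering G (m + 1) :=
  fun v => (y v).2.trans (τ v)

/-- The branch as a function of the random bits and of the permutations of the ports. -/
def randomBranch (τ : PortNumbering G (m + 1)) (t : ℕ) (d : G.Dart)
    (y : V → R × Equiv.Perm (Fin (m + 1))) : Branch R m t :=
  graphBranch (fun v => (y v).1) (permutedPorts τ y) t d

theorem dependsOn_randomBranch (τ : PortNumbering G (m + 1)) (t : ℕ) (d : G.Dart) :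
    DependsOn (randomBranch (R := R) τ t d) (branchNodes G t d) := fun y y' h =>
  graphBranch_congr fun v hv => ⟨by rw [h v hv], by simp only [permutedPorts]; rw [h v hv]⟩

/-- The branch, given the bits and the ports of its root and the branches behind all neighbors of the
root. -/
def assemble (τ : PortNumbering G (m + 1)) (t : ℕ) (d : G.Dart)
    (p : (R × Equiv.Perm (Fin (m + 1))) × (G.neighborSet d.fst → Branch R m t)) :
    Branch.Unfolded R m t :=
  ((p.1.1, p.1.2.symm ((τ d.fst).symm ⟨d.snd, d.adj⟩)), fun j =>
    p.2 (τ d.fst (p.1.2 ((p.1.2.symm ((τ d.fst).symm ⟨d.snd, d.adj⟩)).succAbove j))))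

variable [MeasurableSpace R]

theorem measurable_assemble (τ : PortNumbering G (m + 1)) (t : ℕ) (d : G.Dart) :
    Measurable (assemble (R := R) τ t d) := by
  refine Measurable.prodMk (Measurable.prodMk (by fun_prop) ?_) (measurable_pi_lambda _ fun j => ?_)
  · exact (measurable_of_finite
      (fun σ : Equiv.Perm (Fin (m + 1)) => σ.symm ((τ d.fst).symm ⟨d.snd, d.adj⟩))).comp
      (measurable_snd.comp measurable_fst)
  · exact measurable_of_index
      (f := fun (σ : Equiv.Perm (Fin (m + 1)))
        (p : (R × Equiv.Perm (Fin (m + 1))) × (G.neighborSet d.fst → Branch R m t)) =>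
        p.2 (τ d.fst (σ ((σ.symm ((τ d.fst).symm ⟨d.snd, d.adj⟩)).succAbove j))))
      (i := fun p => p.1.2) (measurable_snd.comp measurable_fst)
      fun σ => (measurable_pi_apply _).comp measurable_snd

theorem measurable_randomBranch (τ : PortNumbering G (m + 1)) : ∀ t (d : G.Dart),
    Measurable (randomBranch (R := R) τ t d)
  | 0, _ => measurable_const
  | t + 1, d => by
    have h : Measurable fun (y : V → R × Equiv.Perm (Fin (m + 1))) =>
        (y d.fst, fun u : G.neighborSet d.fst =>
          randomBranch τ t ⟨(u, d.fst), u.2.symm⟩ y) :=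
      (measurable_pi_apply d.fst).prodMk (measurable_pi_lambda _ fun u =>
        measurable_randomBranch τ t _)
    exact (measurable_assemble τ t d).comp h

variable [Fintype V] (ν : Measure R) [IsProbabilityMeasure ν]

/-- The law of the private bits and of the permutations of the ports. -/
noncomputable def nodeMeasure (m : ℕ) (V : Type) [Fintype V] :
    Measure (V → R × Equiv.Perm (Fin (m + 1))) :=
  Measure.pi fun _ : V => ν.prod (permMeasure (m + 1))

instance : IsProbabilityMeasure (nodeMeasure ν m V) := by
  unfold nodeMeasure; infer_instance

-- The permutation at the root decides which neighbors fill the branch and in which order. Since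
-- their branches are i.i.d., the law of the selected ones does not depend on that permutation.
omit [Fintype V] in
theorem measurePreserving_assemble (τ : PortNumbering G (m + 1)) (t : ℕ) (d : G.Dart)
    [Fintype (G.neighborSet d.fst)] :
    MeasurePreserving (assemble (R := R) τ t d)
      ((ν.prod (permMeasure (m + 1))).prod
        (Measure.pi fun _ : G.neighborSet d.fst => branchMeasure ν m t))
      (branchMeasure ν m (t + 1)) := by
  have h1 : MeasurePreserving (fun p : R × Equiv.Perm (Fin (m + 1)) =>
      (p.1, p.2.symm ((τ d.fst).symm ⟨d.snd, d.adj⟩))) (ν.prod (permMeasure (m + 1)))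
      (ν.prod (portMeasure m)) :=
    (MeasurePreserving.id ν).prod (measurePreserving_perm_symm_apply _)
  refine MeasurePreserving.skew_product h1
    (g := fun p (B : G.neighborSet d.fst → Branch R m t) (j : Fin m) => B (τ d.fst (p.2 ((p.2.symm ((τ d.fst).symm ⟨d.snd, d.adj⟩)).succAbove j))))
    (measurable_snd.comp (measurable_assemble τ t d)) (Filter.Eventually.of_forall fun p => ?_)
  exact pi_map_precomp _ ((τ d.fst).injective.comp
    (p.2.injective.comp Fin.succAbove_right_injective))

/-- In a graph of large girth a branch has the same law as in the tree. -/
theorem map_randomBranch (τ : PortNumbering G (m + 1)) : ∀ {t : ℕ} (d : G.Dart),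
    ((t + 1 : ℕ) : ℕ∞) < G.egirth → ((2 * t : ℕ) : ℕ∞) ≤ G.egirth →
    (nodeMeasure ν m V).map (randomBranch τ t d) = branchMeasure ν m t
  | 0, d, _, _ => by
    show (nodeMeasure ν m V).map (fun _ => ()) = Measure.dirac ()
    simp
  | t + 1, d, hg, hg2 => by
    classical
    have hgt : ((t + 1 : ℕ) : ℕ∞) < G.egirth := lt_of_le_of_lt (by norm_cast; omega) hg
    have hgt2 : ((2 * t : ℕ) : ℕ∞) < G.egirth :=
      lt_of_lt_of_le (by norm_cast; omega) hg2
    set child : G.neighborSet d.fst → G.Dart := fun u => ⟨(u, d.fst), u.2.symm⟩ with hchild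
    have hmc : Measurable fun y u => randomBranch (R := R) τ t (child u) y :=
      measurable_pi_lambda _ fun u => measurable_randomBranch τ t (child u)
    have hind : iIndepFun (fun u => randomBranch (R := R) τ t (child u)) (nodeMeasure ν m V) :=
      iIndepFun_of_dependsOn _ (fun u => measurable_randomBranch τ t _)
        (fun u => dependsOn_randomBranch τ t _) fun u u' hne =>
          disjoint_branchNodes_of_ne (fun h => hne (Subtype.ext h)) hgt hgt2
    have hlaw : (nodeMeasure ν m V).map (fun y u => randomBranch (R := R) τ t (child u) y)
        = Measure.pi fun _ => branchMeasure ν m t := by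
      rw [(iIndepFun_iff_map_fun_eq_pi_map
        fun u => (measurable_randomBranch τ t _).aemeasurable).1 hind]
      congr 1
      funext u
      exact map_randomBranch τ (child u) hgt hgt2.le
    have hroot : IndepFun (fun y : V → R × Equiv.Perm (Fin (m + 1)) => y d.fst)
        (fun y u => randomBranch (R := R) τ t (child u) y) (nodeMeasure ν m V) := by
      refine indepFun_of_dependsOn _ (measurable_pi_apply _) hmc (S := {d.fst})
        (T := ⋃ u, branchNodes G t (child u)) (fun y y' h => h _ rfl)
        (fun y y' h => funext fun u => dependsOn_randomBranch τ t _ fun v hv =>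
          h v (Set.mem_iUnion_of_mem u hv)) ?_
      rw [Set.disjoint_singleton_left, Set.mem_iUnion]
      rintro ⟨u, hu⟩
      exact snd_notMem_branchNodes (d := child u) hgt hu
    have hjoint := (indepFun_iff_map_prod_eq_prod_map_map (measurable_pi_apply _).aemeasurable
      hmc.aemeasurable).1 hroot
    rw [hlaw, nodeMeasure, (measurePreserving_eval
      (fun _ : V => ν.prod (permMeasure (m + 1))) d.fst).map_eq] at hjoint
    have hfun : randomBranch (R := R) τ (t + 1) d = assemble τ t d ∘
        fun y => (y d.fst, fun u => randomBranch τ t (child u) y) := rfl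
    rw [hfun]
    refine (Measure.map_map (measurable_assemble τ t d)
      ((measurable_pi_apply _).prodMk hmc)).symm.trans ?_
    rw [nodeMeasure, hjoint]
    exact (measurePreserving_assemble ν τ t d).map_eq

/-- The branches on the two sides of an edge are independent. -/
theorem map_randomBranch_prod (τ : PortNumbering G (m + 1)) {t : ℕ} (d : G.Dart)
    (hg : ((t + 1 : ℕ) : ℕ∞) < G.egirth) (hg2 : ((2 * t : ℕ) : ℕ∞) ≤ G.egirth) :
    (nodeMeasure ν m V).map (fun y => (randomBranch τ t d y, randomBranch τ t d.symm y))
      = (branchMeasure ν m t).prod (branchMeasure ν m t) := by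
  have hI : IndepFun (randomBranch (R := R) τ t d) (randomBranch τ t d.symm)
      (nodeMeasure ν m V) :=
    indepFun_of_dependsOn _ (measurable_randomBranch τ t d) (measurable_randomBranch τ t d.symm)
      (dependsOn_randomBranch τ t d) (dependsOn_randomBranch τ t d.symm)
      (disjoint_branchNodes_symm hg hg2)
  rw [(indepFun_iff_map_prod_eq_prod_map_map (measurable_randomBranch τ t d).aemeasurable
    (measurable_randomBranch τ t d.symm).aemeasurable).1 hI, map_randomBranch ν τ d hg hg2,
    map_randomBranch ν τ d.symm hg hg2]

end LocalModel

namespace LocalModel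
open ProbabilityTheory

/-! ### Transfer to the graph -/

instance : IsProbabilityMeasure bitMeasure := by
  unfold bitMeasure; infer_instance

/-- Permuting the ports of a fixed numbering by independent uniform permutations gives a uniform
numbering. The finite average thus becomes a probability over independent data at the nodes. -/
theorem sum_portNumberings {V : Type} [Fintype V] {G : SimpleGraph V} {R : Type} {m : ℕ}
    [MeasurableSpace R] (ν : Measure R) [IsProbabilityMeasure ν] (τ : PortNumbering G (m + 1))
    [Fintype (PortNumbering G (m + 1))] {P : (V → R) → PortNumbering G (m + 1) → Prop}
    (hP : ∀ π, MeasurableSet {x | P x π}) :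
    ∑ π, (Measure.pi fun _ : V => ν) {x | P x π} =
      Fintype.card (PortNumbering G (m + 1)) *
        nodeMeasure ν m V {y | P (fun v => (y v).1) (permutedPorts τ y)} := by
  classical
  let e : (V → Equiv.Perm (Fin (m + 1))) ≃ PortNumbering G (m + 1) :=
    { toFun := fun σ v => (σ v).trans (τ v)
      invFun := fun π v => (π v).trans (τ v).symm
      left_inv := fun σ => by funext v; ext; simp
      right_inv := fun π => by funext v; ext; simp }
  set κ := Measure.pi fun _ : V => permMeasure (m + 1)
  have hS : MeasurableSet {p : (V → R) × (V → Equiv.Perm (Fin (m + 1))) | P p.1 (e p.2)} :=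
    measurableSet_setOfPred.2 (measurable_of_index
      (f := fun (σ : V → Equiv.Perm (Fin (m + 1)))
        (p : (V → R) × (V → Equiv.Perm (Fin (m + 1)))) => P p.1 (e σ))
      measurable_snd fun σ => measurableSet_setOfPred.1 (measurable_fst (hP (e σ))))
  have hmp := measurePreserving_arrowProdEquivProdArrow R (Equiv.Perm (Fin (m + 1))) V
    (fun _ => ν) fun _ => permMeasure (m + 1)
  have h1 : nodeMeasure ν m V {y | P (fun v => (y v).1) (permutedPorts τ y)}
      = ∑ σ, (Measure.pi fun _ : V => ν) {x | P x (e σ)} * κ {σ} := by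
    refine (hmp.measure_preimage hS.nullMeasurableSet).trans ?_
    rw [Measure.prod_apply_symm hS, lintegral_fintype]
    rfl
  have h2 : ∀ σ, κ {σ} = (Fintype.card (PortNumbering G (m + 1)) : ENNReal)⁻¹ := fun σ => by
    have h3 : ∀ s : Equiv.Perm (Fin (m + 1)), permMeasure (m + 1) {s}
        = (Fintype.card (Equiv.Perm (Fin (m + 1))) : ENNReal)⁻¹ := fun s => by
      have := permMeasure_apply {s}
      simpa using this
    have h4 : Fintype.card (PortNumbering G (m + 1))
        = Fintype.card (Equiv.Perm (Fin (m + 1))) ^ Fintype.card V := by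
      rw [← Fintype.card_congr e]; simp
    simp only [κ, Measure.pi_singleton, h3]
    rw [h4, Finset.prod_const, Finset.card_univ, Nat.cast_pow, ENNReal.inv_pow]
  have hne : (Fintype.card (PortNumbering G (m + 1)) : ENNReal) ≠ 0 := by
    have : Nonempty (PortNumbering G (m + 1)) := ⟨τ⟩
    exact_mod_cast Fintype.card_ne_zero
  rw [h1]
  simp_rw [h2]
  rw [← Finset.sum_mul, mul_comm, mul_assoc,
    ENNReal.inv_mul_cancel hne (ENNReal.natCast_ne_top _), mul_one]
  exact (Equiv.sum_comp e fun π => (Measure.pi fun _ : V => ν) {x | P x π}).symm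

/-- With `a` the indicator of label `M`, a disagreement is `a d + a d.symm - 2 * a d * a d.symm`.
The sum of `a` is `b * n`, and each matched edge is counted by two darts in the product term. -/
theorem badness_mul_eq {V : Type} [Fintype V] {G : SimpleGraph V} [Fintype G.Dart] {b : ℕ}
    (hb : 1 ≤ b) [Nonempty V] {ℓ : HalfEdgeLabeling G} (h : IsGrabbing b ℓ) :
    badness b ℓ * (2 * b * Fintype.card V) =
      ∑ d : G.Dart, {d | ¬ (ℓ d = Label.M ↔ ℓ d.symm = Label.M)}.indicator (fun _ => (1 : ℝ)) d := by
  classical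
  set a : G.Dart → ℝ := fun d => if ℓ d = Label.M then 1 else 0 with ha
  have h1 : ∀ d, {d | ¬ (ℓ d = Label.M ↔ ℓ d.symm = Label.M)}.indicator (fun _ => (1 : ℝ)) d
      = a d + a d.symm - 2 * (a d * a d.symm) := fun d => by
    by_cases h1 : ℓ d = Label.M <;> by_cases h2 : ℓ d.symm = Label.M <;>
      simp [ha, h1, h2]
    norm_num
  have hM : ∑ d, a d = b * Fintype.card V := by
    rw [ha, Finset.sum_boole, Finset.card_eq_sum_card_fiberwise (f := fun d : G.Dart => d.fst)
      (t := Finset.univ) (by simp)]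
    have : ∀ v, (Finset.filter (fun d : G.Dart => d.fst = v)
        (Finset.univ.filter fun d => ℓ d = Label.M)).card = b := fun v => by
      rw [← h v, Set.ncard_eq_toFinset_card']
      congr 1
      ext d
      simp [and_comm]
    simp only [this]
    simp [mul_comm]
  have hsymm : ∑ d : G.Dart, a d.symm = ∑ d, a d :=
    Equiv.sum_comp (SimpleGraph.Dart.symm_involutive (G := G)).toPerm a
  have hMM : ∑ d : G.Dart, a d * a d.symm = 2 * quality ℓ := by
    have h2 : ∀ d : G.Dart, a d * a d.symm
        = if ℓ d = Label.M ∧ ℓ d.symm = Label.M then 1 else 0 := fun d => by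
      by_cases h1 : ℓ d = Label.M <;> by_cases h2 : ℓ d.symm = Label.M <;> simp [ha, h1, h2]
    set S := Finset.univ.filter fun d : G.Dart => ℓ d = Label.M ∧ ℓ d.symm = Label.M with hS
    simp_rw [h2]
    rw [Finset.sum_boole, ← hS,
      Finset.card_eq_sum_card_fiberwise (f := fun d : G.Dart => d.edge) (t := S.image fun d => d.edge)
      (fun d hd => Finset.mem_coe.2 (Finset.mem_image_of_mem _ hd))]
    have hfib : ∀ e ∈ S.image fun d : G.Dart => d.edge,
        (S.filter fun d : G.Dart => d.edge = e).card = 2 := fun e he => by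
      obtain ⟨d, hd, rfl⟩ := Finset.mem_image.1 he
      have hd' := (Finset.mem_filter.1 hd).2
      have : (S.filter fun d' : G.Dart => d'.edge = d.edge) = {d, d.symm} := by
        ext d'
        simp only [hS, Finset.mem_filter, Finset.mem_univ, true_and, Finset.mem_insert,
          Finset.mem_singleton, SimpleGraph.dart_edge_eq_iff]
        constructor
        · exact fun h => h.2
        · rintro (rfl | rfl)
          · exact ⟨hd', Or.inl rfl⟩
          · exact ⟨⟨hd'.2, by rw [SimpleGraph.Dart.symm_symm]; exact hd'.1⟩, Or.inr rfl⟩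
      rw [this, Finset.card_pair d.symm_ne.symm]
    rw [Finset.sum_congr rfl hfib, Finset.sum_const, quality]
    have hq : matchedEdges ℓ = (S.image fun d : G.Dart => d.edge : Finset (Sym2 V)) := by
      ext e
      simp only [matchedEdges, hS, Set.mem_ofPred_eq, Finset.coe_image, Set.mem_image,
        Finset.mem_coe, Finset.mem_filter, Finset.mem_univ, true_and]
      exact exists_congr fun d => and_comm
    rw [hq, Set.ncard_coe_finset]
    simp [mul_comm]
  have hn : (Fintype.card V : ℝ) ≠ 0 := by exact_mod_cast Fintype.card_ne_zero
  have hb0 : (b : ℝ) ≠ 0 := by exact_mod_cast (by omega : b ≠ 0)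
  simp_rw [h1]
  rw [Finset.sum_sub_distrib, Finset.sum_add_distrib, ← Finset.mul_sum, hsymm, hM, hMM, badness]
  field_simp
  ring

/-! ### The algorithm as a rule on views of the tree. -/

section Algorithm

variable {V : Type} {G : SimpleGraph V} {m : ℕ} (A : LocalAlgorithm (m + 1)) (s : BitStream)

/-- The views for which `A` grabs port `i`. -/
def viewGrabs (i : Fin (m + 1)) : Set (View BitStream m A.rounds) :=
  {q | A.output (evalState A s A.rounds q) i = Label.M}

theorem measurableSet_viewGrabs (i : Fin (m + 1)) : MeasurableSet (viewGrabs A s i) :=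
  ((measurable_pi_apply i).comp (A.measurable_output.comp (measurable_evalState A s A.rounds)))
    (show MeasurableSet {Label.M} from trivial)

/-- The views for which `A` grabs port `i`, with a default decision on the views that are not
handled correctly. -/
def safeGrabs (b : ℕ) (i : Fin (m + 1)) : Set (View BitStream m A.rounds) :=
  {q | ({j | q ∈ viewGrabs A s j}.ncard = b ∧ q ∈ viewGrabs A s i) ∨
    (¬ {j | q ∈ viewGrabs A s j}.ncard = b ∧ (i : ℕ) < b)}

theorem measurableSet_safeGrabs (b : ℕ) (i : Fin (m + 1)) :
    MeasurableSet (safeGrabs A s b i) := by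
  classical
  have h1 : ∀ q, {j | q ∈ viewGrabs A s j}.ncard
      = ∑ j, (viewGrabs A s j).indicator (fun _ => 1) q := fun q => by
    rw [Set.ncard_eq_toFinset_card']
    simp [Set.indicator_apply]
  have h2 : Measurable fun q => {j | q ∈ viewGrabs A s j}.ncard := by
    simp_rw [h1]
    exact Finset.measurable_sum _ fun j _ =>
      measurable_const.indicator (measurableSet_viewGrabs A s j)
  have h3 : MeasurableSet {q | {j | q ∈ viewGrabs A s j}.ncard = b} :=
    h2 (measurableSet_singleton b)
  exact (h3.inter (measurableSet_viewGrabs A s i)).union (h3.compl.inter (MeasurableSet.const _))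

theorem ncard_safeGrabs {b : ℕ} (hb : b ≤ m + 1) (q : View BitStream m A.rounds) :
    {i | q ∈ safeGrabs A s b i}.ncard = b := by
  by_cases h : {j | q ∈ viewGrabs A s j}.ncard = b
  · simp [safeGrabs, h]
  · have : {i | q ∈ safeGrabs A s b i} = Set.range (Fin.castLE hb) := by
      ext i
      simp only [safeGrabs, h, Set.mem_ofPred_eq, false_and, not_false_eq_true, true_and, false_or,
        Set.mem_range]
      exact ⟨fun hi => ⟨⟨i, hi⟩, rfl⟩, by rintro ⟨j, rfl⟩; exact j.2⟩
    rw [this, Set.ncard_range_of_injective (Fin.castLE_injective hb)]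
    simp

theorem mem_viewGrabs_graphView (x : V → BitStream) (π : PortNumbering G (m + 1)) (d : G.Dart) :
    graphView x π A.rounds d.fst ∈ viewGrabs A s (portOf π d) ↔
      A.outputLabeling π (x, s) d = Label.M := by
  show A.output (evalState A s A.rounds _) _ = _ ↔ _
  rw [evalState_graphView]
  rfl

theorem mem_grabSet_safeGrabs {b : ℕ} (hA : A.IsNoErrorGrabbing G b) (x : V → BitStream)
    (π : PortNumbering G (m + 1)) (d : G.Dart) :
    (graphBranch x π (A.rounds + 1) d, graphBranch x π (A.rounds + 1) d.symm) ∈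
      grabSet (safeGrabs A s b) ↔ A.outputLabeling π (x, s) d = Label.M := by
  -- On views that occur in `G` the no-error property forces the right count, so the default choice
  -- in `safeGrabs` is never made there.
  have hcard : {j | graphView x π A.rounds d.fst ∈ viewGrabs A s j}.ncard = b := by
    rw [← hA π (x, s) d.fst]
    refine Set.ncard_congr (fun i _ => (backDart π d.fst i).symm) ?_ ?_ ?_
    · intro i hi
      refine ⟨rfl, ?_⟩
      rw [← mem_viewGrabs_graphView, portOf_symm_backDart]
      exact hi
    · intro i j _ _ h
      rw [← portOf_symm_backDart π d.fst i, h, portOf_symm_backDart]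
    · rintro d' ⟨hd, hM⟩
      refine ⟨portOf π d', ?_, ?_⟩
      · rw [← mem_viewGrabs_graphView] at hM
        rw [← hd]; exact hM
      · rw [← hd, backDart_portOf, SimpleGraph.Dart.symm_symm]
  show nodeView _ (Branch.trunc _) ∈ safeGrabs A s b (portOf π d) ↔ _
  rw [trunc_graphBranch, nodeView_graphBranch, ← mem_viewGrabs_graphView]
  simp [safeGrabs, hcard]

/-- The half-edges at which exactly one of the two ends grabs the edge. -/
def disagree (π : PortNumbering G (m + 1)) (d : G.Dart) :
    Set ((V → BitStream) × BitStream) :=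
  {ω | ¬ (A.outputLabeling π ω d = Label.M ↔ A.outputLabeling π ω d.symm = Label.M)}

theorem measurableSet_disagree (π : PortNumbering G (m + 1)) (d : G.Dart) :
    MeasurableSet (disagree A π d) := by
  have h : ∀ d : G.Dart, MeasurableSet {ω | A.outputLabeling π ω d = Label.M} := fun d =>
    ((measurable_pi_apply _).comp (A.measurable_output.comp (measurable_stateAt A π _ _)))
      (show MeasurableSet {Label.M} from trivial)
  exact measurableSet_not_iff (h d) (h d.symm)

variable [Fintype V]

instance : IsProbabilityMeasure (randomnessMeasure V) := by
  unfold randomnessMeasure; infer_instance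

theorem le_sum_disagree [Fintype (PortNumbering G (m + 1))] (τ : PortNumbering G (m + 1)) {b : ℕ}
    (hb : 1 ≤ b) (hbm : 2 * b ≤ m + 1) (hA : A.IsNoErrorGrabbing G b)
    (hg : ((4 * A.rounds : ℕ) : ℕ∞) < G.egirth) (d : G.Dart) :
    Fintype.card (PortNumbering G (m + 1)) * ((m + 1 : ENNReal)⁻¹ * b) ≤
      ENNReal.ofReal (46 * √b) ^ A.rounds * ∑ π, randomnessMeasure V (disagree A π d) := by
  have hg3 : ((3 : ℕ) : ℕ∞) ≤ G.egirth := SimpleGraph.three_le_egirth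
  -- The mismatch involves branches of depth `A.rounds + 1`. For zero rounds `hg` is too weak for
  -- them, and the girth being at least `3` in a simple graph takes over.
  have hg1 : ((A.rounds + 1 + 1 : ℕ) : ℕ∞) < G.egirth := by
    rcases Nat.eq_zero_or_pos A.rounds with h | h
    · rw [h]; exact lt_of_lt_of_le (by norm_num) hg3
    · exact lt_of_le_of_lt (by norm_cast; omega) hg
  have hg2 : ((2 * (A.rounds + 1) : ℕ) : ℕ∞) ≤ G.egirth := by
    rcases Nat.eq_zero_or_pos A.rounds with h | h
    · rw [h]; exact le_trans (by norm_num) hg3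
    · exact le_trans (by norm_cast; omega) hg.le
  -- With the shared bits frozen, the random output on the edge is that of a deterministic rule on
  -- the tree; the lower bound holds for every `s` and is integrated afterwards.
  have hslice : ∀ (s : BitStream), ∑ π, (Measure.pi fun _ : V => bitMeasure)
      {x | (x, s) ∈ disagree A π d} =
      Fintype.card (PortNumbering G (m + 1)) * mismatch bitMeasure (safeGrabs A s b) := fun s => by
    rw [sum_portNumberings bitMeasure τ fun π =>
      measurable_prodMk_right (measurableSet_disagree A π d)]
    congr 1
    have hm : MeasurableSet {p | ¬ (p ∈ grabSet (safeGrabs A s b) ↔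
        p.swap ∈ grabSet (safeGrabs A s b))} :=
      measurableSet_not_iff (measurableSet_grabSet (measurableSet_safeGrabs A s b))
        (measurable_swap (measurableSet_grabSet (measurableSet_safeGrabs A s b)))
    rw [mismatch, ← map_randomBranch_prod bitMeasure τ d hg1 hg2, Measure.map_apply
      ((measurable_randomBranch τ _ d).prodMk (measurable_randomBranch τ _ d.symm)) hm]
    congr 1
    ext y
    exact not_congr (iff_congr
      (mem_grabSet_safeGrabs A s hA (fun v => (y v).1) (permutedPorts τ y) d).symm
      (mem_grabSet_safeGrabs A s hA (fun v => (y v).1) (permutedPorts τ y) d.symm).symm)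
  have hmeas : ∀ π, Measurable fun s => (Measure.pi fun _ : V => bitMeasure)
      {x | (x, s) ∈ disagree A π d} := fun π =>
    measurable_measure_prodMk_right (measurableSet_disagree A π d)
  have hint : ∑ π, randomnessMeasure V (disagree A π d)
      = ∫⁻ s, ∑ π, (Measure.pi fun _ : V => bitMeasure) {x | (x, s) ∈ disagree A π d}
        ∂bitMeasure := by
    rw [lintegral_finsetSum _ fun π _ => hmeas π]
    exact Finset.sum_congr rfl fun π _ => Measure.prod_apply_symm (measurableSet_disagree A π d)
  rw [hint, ← lintegral_const_mul _ (Finset.measurable_sum _ fun π _ => hmeas π)]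
  calc _ = ∫⁻ _, Fintype.card (PortNumbering G (m + 1)) * ((m + 1 : ENNReal)⁻¹ * b)
        ∂bitMeasure := by simp
    _ ≤ _ := by
        refine lintegral_mono fun s => ?_
        dsimp only
        rw [hslice s, mul_left_comm (ENNReal.ofReal _ ^ _)]
        refine mul_le_mul' le_rfl ?_
        exact le_mismatch bitMeasure (measurableSet_safeGrabs A s b) hb hbm
          (ncard_safeGrabs A s (by omega))

theorem integral_badness (π : PortNumbering G (m + 1)) [Fintype G.Dart] [Nonempty V] {b : ℕ}
    (hb : 1 ≤ b) (hA : A.IsNoErrorGrabbing G b) :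
    (∫ ω, badness b (A.outputLabeling π ω) ∂randomnessMeasure V) * (2 * b * Fintype.card V) =
      ∑ d : G.Dart, (randomnessMeasure V).real (disagree A π d) := by
  rw [← integral_mul_const]
  have h : ∀ ω, badness b (A.outputLabeling π ω) * (2 * b * Fintype.card V)
      = ∑ d : G.Dart, (disagree A π d).indicator (fun _ => (1 : ℝ)) ω := fun ω =>
    badness_mul_eq hb (hA π ω)
  simp_rw [h]
  rw [integral_finsetSum _ fun d _ =>
    (integrable_const (1 : ℝ)).indicator (measurableSet_disagree A π d)]
  exact Finset.sum_congr rfl fun d _ => integral_indicator_one (measurableSet_disagree A π d)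

theorem le_sum_disagree_real [Fintype (PortNumbering G (m + 1))] (τ : PortNumbering G (m + 1))
    {b : ℕ} (hb : 1 ≤ b) (hbm : 2 * b ≤ m + 1) (hA : A.IsNoErrorGrabbing G b)
    (hg : ((4 * A.rounds : ℕ) : ℕ∞) < G.egirth) (d : G.Dart) :
    Fintype.card (PortNumbering G (m + 1)) * ((m + 1 : ℝ)⁻¹ * b) ≤
      (46 * √b) ^ A.rounds * ∑ π, (randomnessMeasure V).real (disagree A π d) := by
  have h := le_sum_disagree A τ hb hbm hA hg d
  have hfin : ENNReal.ofReal (46 * √b) ^ A.rounds *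
      ∑ π, randomnessMeasure V (disagree A π d) ≠ ⊤ :=
    ENNReal.mul_ne_top (ENNReal.pow_ne_top ENNReal.ofReal_ne_top)
      (ENNReal.sum_ne_top.2 fun π _ => measure_ne_top _ _)
  have h2 := ENNReal.toReal_mono hfin h
  have h3 : ((m + 1 : ENNReal)).toReal = m + 1 := by
    rw [ENNReal.toReal_add (by simp) (by simp)]; simp
  rw [ENNReal.toReal_mul, ENNReal.toReal_mul, ENNReal.toReal_mul, ENNReal.toReal_pow,
    ENNReal.toReal_ofReal (by positivity), ENNReal.toReal_sum fun π _ => measure_ne_top _ _,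
    ENNReal.toReal_inv, h3, ENNReal.toReal_natCast, ENNReal.toReal_natCast] at h2
  exact h2

/-- Summation over the `n * (m + 1)` darts cancels the probability `b / (m + 1)` against the
normalization `2 * b * n` of the badness; only the factor `2` remains. -/
theorem card_le_sum_integral_badness [Fintype (PortNumbering G (m + 1))]
    (τ : PortNumbering G (m + 1)) [Nonempty V] [Fintype G.Dart] {b : ℕ}
    (hdart : Fintype.card G.Dart = Fintype.card V * (m + 1)) (hb : 1 ≤ b)
    (hbm : 2 * b ≤ m + 1) (hA : A.IsNoErrorGrabbing G b)
    (hg : ((4 * A.rounds : ℕ) : ℕ∞) < G.egirth) :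
    (Fintype.card (PortNumbering G (m + 1)) : ℝ) ≤ 2 * ((46 * √b) ^ A.rounds *
      ∑ π : PortNumbering G (m + 1),
        ∫ ω, badness b (A.outputLabeling π ω) ∂randomnessMeasure V) := by
  have hn0 : (0 : ℝ) < Fintype.card V := by exact_mod_cast Fintype.card_pos
  have hb0 : (0 : ℝ) < b := by exact_mod_cast hb
  have hsum := Finset.sum_le_sum fun (d : G.Dart) (_ : d ∈ Finset.univ) =>
    le_sum_disagree_real A τ hb hbm hA hg d
  have hI : ∑ π : PortNumbering G (m + 1), ∑ d, (randomnessMeasure V).real (disagree A π d)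
      = (∑ π : PortNumbering G (m + 1), ∫ ω, badness b (A.outputLabeling π ω)
        ∂randomnessMeasure V) * (2 * b * Fintype.card V) := by
    rw [Finset.sum_mul]
    exact Finset.sum_congr rfl fun π _ => (integral_badness A π hb hA).symm
  rw [Finset.sum_const, Finset.card_univ, nsmul_eq_mul, hdart, ← Finset.mul_sum,
    Finset.sum_comm, hI] at hsum
  generalize (∑ π : PortNumbering G (m + 1), ∫ ω, badness b (A.outputLabeling π ω)
    ∂randomnessMeasure V) = I at hsum ⊢
  generalize (Fintype.card (PortNumbering G (m + 1)) : ℝ) = N at hsum ⊢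
  generalize (46 * √(b : ℝ)) ^ A.rounds = K at hsum ⊢
  have hm : (0 : ℝ) < m + 1 := by positivity
  refine le_of_mul_le_mul_right (a := b * (Fintype.card V : ℝ)) ?_ (by positivity)
  calc N * (b * (Fintype.card V : ℝ))
      = ((Fintype.card V * (m + 1) : ℕ) : ℝ) * (N * ((m + 1 : ℝ)⁻¹ * b)) := by
        push_cast; field_simp
    _ ≤ _ := hsum
    _ = _ := by ring

/-- Lower bound for the expected badness of a fast algorithm. -/
theorem le_expectedBadness [Nonempty V] [G.LocallyFinite] {b : ℕ}
    (hreg : G.IsRegularOfDegree (m + 1)) (hb : 1 ≤ b)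
    (hbm : 2 * b ≤ m + 1) (hA : A.IsNoErrorGrabbing G b)
    (hg : ((4 * A.rounds : ℕ) : ℕ∞) < G.egirth) :
    1 / 2 ≤ (46 * √b) ^ A.rounds * A.expectedBadness G b := by
  classical
  have τ : PortNumbering G (m + 1) := fun v =>
    (Fintype.equivFinOfCardEq ((G.card_neighborSet_eq_degree v).trans (hreg v))).symm
  have hdart : Fintype.card G.Dart = Fintype.card V * (m + 1) := by
    rw [G.dart_card_eq_sum_degrees, Finset.sum_congr rfl
      fun v _ => (by convert hreg v : _ = m + 1)]
    simp
  have : Nonempty (PortNumbering G (m + 1)) := ⟨τ⟩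
  have key : ∀ _ : Fintype (PortNumbering G (m + 1)), 1 / 2 ≤ (46 * √b) ^ A.rounds *
      ((∑ π : PortNumbering G (m + 1), ∫ ω, badness b (A.outputLabeling π ω)
        ∂randomnessMeasure V) / (Fintype.card (PortNumbering G (m + 1)) : ℝ)) := by
    intro _
    have h := card_le_sum_integral_badness A τ hdart hb hbm hA hg
    have hN : (0 : ℝ) < Fintype.card (PortNumbering G (m + 1)) := by
      exact_mod_cast Fintype.card_pos
    rw [← mul_div_assoc, le_div_iff₀ hN]
    linarith
  exact key _

end Algorithm

end LocalModel

/-! ### From the bound on the badness to the bound on the running time. -/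

theorem mainTheorem4 :
    ∃ c : ℝ, 1 < c ∧
      ∀ (ε : ℝ), 0 < ε →
      ∀ (V : Type) [Fintype V] (G : SimpleGraph V) [G.LocallyFinite] (n Δ b : ℕ),
        Fintype.card V = n →
        G.IsRegularOfDegree Δ →
        ENNReal.ofReal (ε * Real.logb Δ n) ≤ (G.egirth : ENNReal) →
        1 ≤ b →
        (b : ℝ) ≤ (Δ : ℝ) / 2 →
        ∀ (p : ℝ), 0 < p →
        ∀ A : LocalModel.LocalAlgorithm Δ,
          A.IsNoErrorGrabbing G b →
          A.expectedBadness G b ≤ p →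
          min (ε / 4 * Real.logb Δ n)
              (Real.log (1 / (2 * p)) / Real.log (c * Real.sqrt b)) ≤ (A.rounds : ℝ) := by
  refine ⟨46, by norm_num, ?_⟩
  intro ε hε V _ G _ n Δ b hn hreg hgirth hb hbΔ p hp A hA hbad
  rcases le_or_gt (ε / 4 * Real.logb Δ n) A.rounds with hT | hT
  · exact min_le_of_left_le hT
  refine min_le_of_right_le ?_
  -- For the empty graph the logarithm of `n` is zero, which contradicts `hT`.
  have hV : Nonempty V := by
    by_contra hV
    have : IsEmpty V := not_nonempty_iff.1 hV
    have h0 : n = 0 := by rw [← hn]; simp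
    rw [h0] at hT
    simp only [Nat.cast_zero, Real.logb_zero, mul_zero] at hT
    exact absurd hT (not_lt.2 (Nat.cast_nonneg _))
  have h2b : 2 * b ≤ Δ := by
    have : (2 * b : ℝ) ≤ Δ := by linarith
    exact_mod_cast this
  obtain ⟨m, rfl⟩ : ∃ m, Δ = m + 1 := ⟨Δ - 1, by omega⟩
  -- Failure of the first bound in the minimum, multiplied by `4`, places `4 * A.rounds` strictly
  -- below the girth.
  have hg : ((4 * A.rounds : ℕ) : ℕ∞) < G.egirth := by
    rw [← ENat.toENNReal_lt]
    refine lt_of_lt_of_le ?_ hgirth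
    rw [ENat.toENNReal_coe, ← ENNReal.ofReal_natCast]
    refine (ENNReal.ofReal_lt_ofReal_iff_of_nonneg (Nat.cast_nonneg _)).2 ?_
    have h4 : ((4 * A.rounds : ℕ) : ℝ) = 4 * A.rounds := by push_cast; ring
    rw [h4]
    linarith
  have hmain := LocalModel.le_expectedBadness A hreg hb h2b hA hg
  have hb1 : (1 : ℝ) ≤ √b := Real.one_le_sqrt.2 (by exact_mod_cast hb)
  have hK : 1 < 46 * √(b : ℝ) := by linarith
  rw [div_le_iff₀ (Real.log_pos hK), ← Real.log_pow]
  refine Real.log_le_log (by positivity) ?_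
  rw [div_le_iff₀ (by positivity)]
  have : (46 * √(b : ℝ)) ^ A.rounds * A.expectedBadness G b ≤ (46 * √(b : ℝ)) ^ A.rounds * p := by
    gcongr
  linarith
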